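/- Let $X\subseteq\mathbb C$ be a domain (non-empty, open, connected) and let $H$ be a Hilbert space of holomorphic functions on $X$ with reproducing kernels $k_x\in H$, $\langle f,k_x\rangle=f(x)$ for $f\in H$, $x\in X$. Assume that for every $x\in X$ there is $h\in H$ with $h(x)\ne0$, and put $\hat k_x=k_x/\|k_x\|$. Define $$\delta(x,y)=\sqrt{1-|\langle\hat k_x,\hat k_y\rangle|^2},\qquad \hat\delta(x,y)=\sqrt2\,\sqrt{1-|\langle\hat k_x,\hat k_y\rangle|}.$$ Fix $r\in\{1,2,\dots,\infty\}$; "smooth" means of class $C^r$. The Fubini–Study metric on the projective space $P(H)$ is the Riemannian metric which gives the tangent vector at $[v]$ represented by $w\in H$ the length $\sqrt{\|v\|^2\|w\|^2-|\langle v,w\rangle|^2}\,/\,\|v\|^2$. Let $\check\delta$ be the (Riemannian) distance on $X$ of the pullback of this metric under $z\mapsto[k_z]$: $\check\delta(x,y)$ is the infimum of the Fubini–Study lengths of the image curves $t\mapsto[k_{\gamma(t)}]$ over smooth curves $\gamma$ in $X$ from $x$ to $y$. Let $$ds_H^2=\Big(\frac{\partial^2}{\partial z\,\partial\bar z}\log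 k_z(z)\Big)|dz|^2,$$ let $\ell_{BS}(\gamma)$ be the length of a smooth curve $\gamma$ in $X$ measured with $ds_H$, and let $\delta_{BS}(x,y)$ be the infimum of $\ell_{BS}(\gamma)$ over smooth curves $\gamma$ in $X$ from $x$ to $y$. For a distance function $\sigma$ on $X$ and a curve $\gamma:[a,b]\to X$ let $\ell_\sigma(\gamma)$ be the supremum of $\sum_i\sigma(\gamma(t_i),\gamma(t_{i+1}))$ over the partitions of $[a,b]$, and let $\sigma^*(x,y)$ be the infimum of $\ell_\sigma(\gamma)$ over continuous curves $\gamma$ in $X$ from $x$ to $y$. Then: 1. For every smooth curve $\gamma:[a,b]\to X$, $a<b$: $\ \ell_\delta(\gamma)=\ell_{\hat\delta}(\gamma)=\ell_{\check\delta}(\gamma)=\ell_{BS}(\gamma)$. 2. $\delta^*=\hat\delta^*=\check\delta^*=\check\delta=\delta_{BS}$ on $X\times X$, and these are finite; in particular $\check\delta$ is an inner distance. 3. If $\dim H\ge2$, then $\hat\delta(x,y)<\hat\delta^*(x,y)$ for all $x\neq y$ in $X$. 4. If $\dim H\ge2$, then $\delta(x,y)<\delta^*(x,y)$ for all $x\ne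 y$ in $X$. (Equivalently, in 1 and 2 the common values are half of the length and distance given by the metric $4\,ds_H^2=\Delta\log k_z(z)\,|dz|^2$.) -/

import Mathlib

open Set TopologicalSpace
open scoped ENNReal

noncomputable section

/-! ### Lengths of curves and inner distances -/

/-- The length of `γ` on `[a, b]` with respect to a distance function `σ`: the supremum of
`∑ σ (γ tᵢ) (γ tᵢ₊₁)` over the partitions `a = t₀ ≤ t₁ ≤ ⋯ ≤ tₙ = b`. -/
def curveLength {Y : Type*} (σ : Y → Y → ℝ≥0∞) (γ : ℝ → Y) (a b : ℝ) : ℝ≥0∞ :=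
  ⨆ (n : ℕ) (t : ℕ → ℝ) (_ : Monotone t ∧ t 0 = a ∧ t n = b),
    ∑ i ∈ Finset.range n, σ (γ (t i)) (γ (t (i + 1)))

/-- The inner distance `σ*` generated by `σ`: the infimum of the `σ`-lengths of the continuous
curves from `x` to `y`. -/
def innerDist {Y : Type*} [TopologicalSpace Y] (σ : Y → Y → ℝ≥0∞) (x y : Y) : ℝ≥0∞ :=
  ⨅ (γ : ℝ → Y) (_ : ContinuousOn γ (Icc 0 1) ∧ γ 0 = x ∧ γ 1 = y), curveLength σ γ 0 1

/-- `γ` is a curve of class `C^r` on `[a, b]` with values in the open set `U`. -/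
def IsSmoothCurve {U : Opens ℂ} (r : ℕ∞) (γ : ℝ → U) (a b : ℝ) : Prop :=
  ContDiffOn ℝ r (fun t => (γ t : ℂ)) (Icc a b)

/-! ### Wirtinger derivatives -/

/-- `∂f/∂z = (∂f/∂x - i ∂f/∂y) / 2`. -/
def wirtingerDz (f : ℂ → ℂ) (z : ℂ) : ℂ :=
  (fderiv ℝ f z 1 - Complex.I * fderiv ℝ f z Complex.I) / 2

/-- `∂f/∂z̄ = (∂f/∂x + i ∂f/∂y) / 2`. -/
def wirtingerDzbar (f : ℂ → ℂ) (z : ℂ) : ℂ :=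
  (fderiv ℝ f z 1 + Complex.I * fderiv ℝ f z Complex.I) / 2

/-- Extension by zero of a function on `U`, so that derivatives at points of `U` make sense. -/
def zeroExtend (U : Opens ℂ) (u : U → ℂ) (z : ℂ) : ℂ :=
  open Classical in if h : z ∈ U then u ⟨z, h⟩ else 0

/-! ### The Fubini–Study metric -/

/-- The Fubini–Study length of a tangent vector of the projective space `P(H)` at `[v]`, in
homogeneous coordinates: the tangent vector is the image of `w ∈ H = T_v (H ∖ {0})` under the
differential of `H ∖ {0} → P(H)`, and its length is
`√(‖v‖² ‖w‖² - |⟨v, w⟩|²) / ‖v‖²`. -/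
def fubiniStudyNorm {H : Type*} [NormedAddCommGroup H] [InnerProductSpace ℂ H] (v w : H) : ℝ :=
  Real.sqrt (‖v‖ ^ 2 * ‖w‖ ^ 2 - ‖inner ℂ v w‖ ^ 2) / ‖v‖ ^ 2

/-- The length does not depend on the homogeneous coordinates: replacing the representative `v`
of the point by `c v` carries the tangent vector represented by `w` to the one represented by
`c w`, and vectors along the fibre represent `0`. -/
theorem fubiniStudyNorm_smul_add {H : Type*} [NormedAddCommGroup H] [InnerProductSpace ℂ H]
    (v w : H) (c a : ℂ) (hc : c ≠ 0) :
    fubiniStudyNorm (c • v) (c • w + a • v) = fubiniStudyNorm v w := by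
  have hc' : ‖c‖ ≠ 0 := norm_ne_zero_iff.mpr hc
  have h1 : ‖c • w + a • v‖ ^ 2 = ‖c‖ ^ 2 * ‖w‖ ^ 2
      + 2 * (star c * a * inner ℂ w v).re + ‖a‖ ^ 2 * ‖v‖ ^ 2 := by
    rw [@norm_add_sq ℂ, norm_smul, norm_smul, inner_smul_left, inner_smul_right, mul_pow, mul_pow]
    simp [mul_assoc]
  have h2 : inner ℂ (c • v) (c • w + a • v)
      = star c * (c * inner ℂ v w + a * ((‖v‖ : ℂ) ^ 2)) := by
    rw [inner_smul_left, inner_add_right, inner_smul_right, inner_smul_right,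
      inner_self_eq_norm_sq_to_K]
    simp
  have h3 : ‖c * inner ℂ v w + a * ((‖v‖ : ℂ) ^ 2)‖ ^ 2 = ‖c‖ ^ 2 * ‖inner ℂ v w‖ ^ 2
      + 2 * ‖v‖ ^ 2 * (star c * a * inner ℂ w v).re + ‖a‖ ^ 2 * ‖v‖ ^ 4 := by
    rw [← inner_conj_symm w v, show ((‖v‖ : ℂ) ^ 2) = ((‖v‖ ^ 2 : ℝ) : ℂ) by push_cast; rfl,
      show ‖v‖ ^ 4 = (‖v‖ ^ 2) ^ 2 by ring]
    generalize inner ℂ v w = p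
    generalize ‖v‖ ^ 2 = q
    rw [← mul_pow, ← norm_mul, Complex.sq_norm, Complex.sq_norm, Complex.sq_norm]
    simp only [Complex.normSq_apply]
    simp
    ring
  have h4 : ‖c • v‖ ^ 2 * ‖c • w + a • v‖ ^ 2 - ‖inner ℂ (c • v) (c • w + a • v)‖ ^ 2
      = (‖c‖ ^ 2) ^ 2 * (‖v‖ ^ 2 * ‖w‖ ^ 2 - ‖inner ℂ v w‖ ^ 2) := by
    rw [h1, h2, norm_mul, mul_pow, h3, norm_smul, norm_star]
    ring
  unfold fubiniStudyNorm
  rw [h4, Real.sqrt_mul (by positivity), Real.sqrt_sq (by positivity), norm_smul, mul_pow,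
    mul_div_mul_left _ _ (pow_ne_zero 2 hc')]

/-! ### The metrics of a reproducing kernel Hilbert space -/

section Metrics

variable {U : Opens ℂ} (H : Type*) [NormedAddCommGroup H] [InnerProductSpace ℂ H]
  [CompleteSpace H] [RKHS ℂ H U ℂ]

/-- The reproducing kernel `k_x ∈ H` at `x`: `⟨f, k_x⟩ = f x`. -/
def kernelVec (x : U) : H := RKHS.kerFun H x (1 : ℂ)

/-- Mathlib's inner product is conjugate linear in the first variable, so the reproducing
property reads `inner ℂ (k_x) f = f x`. -/
theorem inner_kernelVec (x : U) (f : H) : inner ℂ (kernelVec H x) f = f x := by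
  simp [kernelVec]

/-- The normalized kernel `k_x / ‖k_x‖`. -/
def unitKernelVec (x : U) : H := ((‖kernelVec H x‖⁻¹ : ℝ) : ℂ) • kernelVec H x

/-- `δ(x, y) = √(1 - |⟨k̂_x, k̂_y⟩|²)`. -/
def deltaDist (x y : U) : ℝ≥0∞ :=
  ENNReal.ofReal (Real.sqrt (1 - ‖inner ℂ (unitKernelVec H x) (unitKernelVec H y)‖ ^ 2))

/-- `δ̂(x, y) = √2 √(1 - |⟨k̂_x, k̂_y⟩|)`. -/
def deltaHatDist (x y : U) : ℝ≥0∞ :=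
  ENNReal.ofReal
    (Real.sqrt 2 * Real.sqrt (1 - ‖inner ℂ (unitKernelVec H x) (unitKernelVec H y)‖))

/-- The length of the image in `P(H)` of the curve `γ` under `z ↦ [k_z]`, measured with the
Fubini–Study metric. -/
def fubiniStudyLength (γ : ℝ → U) (a b : ℝ) : ℝ≥0∞ :=
  ∫⁻ t in Icc a b, ENNReal.ofReal
    (fubiniStudyNorm (kernelVec H (γ t)) (derivWithin (fun s => kernelVec H (γ s)) (Icc a b) t))

/-- `δ̌`: the Riemannian distance on `U` of the pullback of the Fubini–Study metric under
`z ↦ [k_z]`. -/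
def deltaCheckDist (r : ℕ∞) (x y : U) : ℝ≥0∞ :=
  ⨅ (γ : ℝ → U) (_ : IsSmoothCurve r γ 0 1 ∧ γ 0 = x ∧ γ 1 = y), fubiniStudyLength H γ 0 1

/-- The density `∂²/∂z∂z̄ log k_z(z)` of `ds_H²`. -/
def bergmanDensity (z : U) : ℝ :=
  (wirtingerDz (wirtingerDzbar
    (zeroExtend U fun w => ((Real.log (kernelVec H w w).re : ℝ) : ℂ))) z).re

/-- The length of `γ` measured with `ds_H`. -/
def bergmanLength (γ : ℝ → U) (a b : ℝ) : ℝ≥0∞ :=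
  ∫⁻ t in Icc a b, ENNReal.ofReal
    (Real.sqrt (bergmanDensity H (γ t)) * ‖derivWithin (fun s => (γ s : ℂ)) (Icc a b) t‖)

/-- `δ_BS`: the distance of the Riemannian metric `ds_H²`. -/
def bergmanDist (r : ℕ∞) (x y : U) : ℝ≥0∞ :=
  ⨅ (γ : ℝ → U) (_ : IsSmoothCurve r γ 0 1 ∧ γ 0 = x ∧ γ 1 = y), bergmanLength H γ 0 1

end Metrics

end

open Filter Topology MeasureTheory

/-! Everything is measured against the Fubini–Study angle θ(x, y) = arccos |⟨k̂_x, k̂_y⟩|. It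
satisfies the triangle inequality (`projAngle_triangle`), and δ = sin θ, δ̂ = 2 sin(θ/2), so δ ≤ δ̂
≤ θ, and all three agree to first order near the diagonal.

The map w ↦ k_{w̄} is weakly holomorphic, hence holomorphic, so it can be differentiated in `H`.
Computing ∂∂̄ log ‖k_z‖² shows that ds_H is the pullback of the Fubini–Study metric
(`bergmanDensity_eq`); hence δ̌ = δ_BS.

On a smooth curve, chord angle, its sine and arc length agree to first order. The local-to-global
principle `le_of_locally_le` turns this into θ ≤ ℓ_BS between the end points and ℓ_BS ≤ ℓ_δ. With δ
≤ δ̂ ≤ θ and the additivity of ℓ_BS this gives all the equalities of lengths.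

For inner distances the curves are only continuous, so δ_BS must be compared with δ pointwise:
δ_BS(z₀, z) ≤ (1 + ε) δ(z₀, z) for z near z₀ (`eventually_bergmanDist_le`). The delicate case is a
zero of ds_H. There, in an affine chart of P(H), the kernel map is (w − P)ⁿ u(w) with u(P) ≠ 0, and
its image of a short segment is almost straight, so its length is almost the norm of its end point.
The same principle yields δ_BS ≤ δ*, which closes the cycle δ_BS ≤ δ* ≤ δ̂* ≤ δ_BS* ≤ δ_BS.

Strictness comes from 2 sin(θ/2) < θ ≤ δ_BS when θ > 0. If θ = 0 with x ≠ y, it comes from δ_BS > 0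
(`bergmanDist_pos`), where dim H ≥ 2 enters through the identity theorem. -/

/-- A Hilbert-space-valued function which is weakly holomorphic on an open set is holomorphic. -/
theorem differentiableOn_of_inner {H : Type*} [NormedAddCommGroup H] [InnerProductSpace ℂ H]
    [CompleteSpace H] {Ψ : ℂ → H} {V : Set ℂ} (hV : IsOpen V)
    (h : ∀ f : H, DifferentiableOn ℂ (fun z => inner ℂ f (Ψ z)) V) :
    DifferentiableOn ℂ Ψ V := by
  intro z₀ hz₀
  obtain ⟨R, hR, hRV⟩ := Metric.nhds_basis_closedBall.mem_iff.1 (hV.mem_nhds hz₀)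
  -- Each scalar function ⟨f, Ψ⟩ is bounded on the compact ball, so uniform boundedness gives a norm
  -- bound for Ψ.
  obtain ⟨M, hM⟩ : ∃ M, ∀ z ∈ Metric.closedBall z₀ R, ‖Ψ z‖ ≤ M := by
    obtain ⟨M, hM⟩ := banach_steinhaus
      (g := fun z : Metric.closedBall z₀ R => innerSL ℂ (Ψ z)) (fun f => by
        obtain ⟨C, hC⟩ := (isCompact_closedBall z₀ R).exists_bound_of_continuousOn
          ((h f).continuousOn.mono hRV)
        refine ⟨C, fun z => ?_⟩
        rw [innerSL_apply_apply, norm_inner_symm]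
        exact hC z z.2)
    exact ⟨M, fun z hz => by simpa using hM ⟨z, hz⟩⟩
  have hM0 : 0 ≤ M := (norm_nonneg _).trans (hM z₀ (Metric.mem_closedBall_self hR.le))
  have hdiff (f : H) {z : ℂ} (hz : z ∈ Metric.closedBall z₀ R) :
      DifferentiableAt ℂ (fun z => inner ℂ f (Ψ z)) z :=
    (h f).differentiableAt (hV.mem_nhds (hRV hz))
  have hsub {z w : ℂ} (hz : z ∈ Metric.closedBall z₀ (R / 2))
      (hw : w ∈ Metric.closedBall z (R / 2)) : w ∈ Metric.closedBall z₀ R := by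
    rw [Metric.mem_closedBall] at *
    linarith [dist_triangle w z z₀]
  -- Cauchy's estimate for ⟨f, Ψ⟩, tested with f = Ψ w − Ψ z itself; one factor ‖f‖ cancels.
  have hlip : ∀ z ∈ Metric.closedBall z₀ (R / 2), ∀ w ∈ Metric.closedBall z₀ (R / 2),
      ‖Ψ w - Ψ z‖ ≤ M / (R / 2) * ‖w - z‖ := by
    intro z hz w hw
    set f := Ψ w - Ψ z with hf
    have hself : ∀ {u}, u ∈ Metric.closedBall z₀ (R / 2) → u ∈ Metric.closedBall z₀ R :=
      fun hu => Metric.closedBall_subset_closedBall (by linarith) hu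
    have key := (convex_closedBall z₀ (R / 2)).norm_image_sub_le_of_norm_deriv_le
      (f := fun z => inner ℂ f (Ψ z)) (C := ‖f‖ * M / (R / 2))
      (fun u hu => hdiff f (hself hu))
      (fun u hu => Complex.norm_deriv_le_of_forall_mem_sphere_norm_le (half_pos hR)
        (DifferentiableOn.diffContOnCl (by
          rw [closure_ball _ (half_pos hR).ne']
          exact fun v hv => (hdiff f (hsub hu hv)).differentiableWithinAt))
        (fun v hv => (norm_inner_le_norm _ _).trans (mul_le_mul_of_nonneg_left
          (hM v (hsub hu (Metric.sphere_subset_closedBall hv))) (norm_nonneg _)))) hz hw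
    rw [← inner_sub_right, ← hf, inner_self_eq_norm_sq_to_K] at key
    by_cases h0 : ‖f‖ = 0
    · rw [h0]; positivity
    have h1 : ‖f‖ * ‖f‖ ≤ ‖f‖ * (M / (R / 2) * ‖w - z‖) := by
      calc ‖f‖ * ‖f‖ = ‖((‖f‖ : ℂ)) ^ 2‖ := by simp [sq]
        _ ≤ _ := key
        _ = _ := by ring
    exact le_of_mul_le_mul_left h1 (lt_of_le_of_ne (norm_nonneg _) (Ne.symm h0))
  have hcont : ContinuousOn Ψ (Metric.closedBall z₀ (R / 2)) := by
    refine LipschitzOnWith.continuousOn (K := (M / (R / 2)).toNNReal)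
      (LipschitzOnWith.of_dist_le_mul fun w hw z hz => ?_)
    rw [dist_eq_norm, dist_eq_norm, Real.coe_toNNReal _ (by positivity)]
    exact hlip z hz w hw
  lift R to NNReal using hR.le
  have hR2 : 0 < R / 2 := half_pos hR
  have hci : CircleIntegrable Ψ z₀ (R / 2 : NNReal) :=
    (hcont.mono Metric.sphere_subset_closedBall).circleIntegrable (by positivity)
  -- The vector-valued Cauchy integral is analytic, and it equals Ψ because the scalar Cauchy
  -- formula gives both the same inner product with every f.
  have hps := hasFPowerSeriesOn_cauchy_integral hci hR2
  refine (hps.analyticAt.differentiableAt.congr_of_eventuallyEq ?_).differentiableWithinAt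
  filter_upwards [Metric.ball_mem_nhds z₀ (show (0 : ℝ) < (R / 2 : NNReal) from hR2)] with w hw
  refine ext_inner_left ℂ fun f => ?_
  have hd : DifferentiableOn ℂ (fun z => inner ℂ f (Ψ z)) (Metric.closedBall z₀ (R / 2 : NNReal)) :=
    fun u hu => (hdiff f (Metric.closedBall_subset_closedBall (by
      push_cast; linarith) hu)).differentiableWithinAt
  have hC := (hd.mono Metric.closure_ball_subset_closedBall).diffContOnCl
    |>.two_pi_i_inv_smul_circleIntegral_sub_inv_smul hw
  rw [← hC, inner_smul_right, smul_eq_mul]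
  congr 1
  simp only [circleIntegral]
  rw [← innerSL_apply_apply ℂ f, ← ContinuousLinearMap.intervalIntegral_comp_comm]
  · simp
  · have : CircleIntegrable (fun z => (z - w)⁻¹ • Ψ z) z₀ (R / 2 : NNReal) := by
      refine ContinuousOn.circleIntegrable (by positivity)
        (ContinuousOn.smul (ContinuousOn.inv₀ (by fun_prop) ?_)
          (hcont.mono Metric.sphere_subset_closedBall))
      intro u hu h0
      rw [sub_eq_zero.1 h0] at hu
      rw [Metric.mem_ball, Metric.mem_sphere.1 hu] at hw
      exact lt_irrefl _ hw
    exact this.out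

/-! ### The kernel vectors as a holomorphic map -/

section
variable {U : Opens ℂ} (H : Type*) [NormedAddCommGroup H] [InnerProductSpace ℂ H]
  [CompleteSpace H] [RKHS ℂ H U ℂ]

/-- The kernel vectors in the coordinate in which they depend holomorphically on the point:
`Ψ z = k_{z̄}`, extended by zero. -/
noncomputable def conjKernel (z : ℂ) : H :=
  open Classical in if h : star z ∈ U then kernelVec H ⟨star z, h⟩ else 0

theorem conjKernel_star (z : U) : conjKernel H (star (z : ℂ)) = kernelVec H z := by
  simp [conjKernel]

theorem isOpen_star_preimage (U : Opens ℂ) : IsOpen ((star : ℂ → ℂ) ⁻¹' (U : Set ℂ)) :=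
  U.isOpen.preimage continuous_star

variable {H}

theorem inner_conjKernel (f : H) (z : ℂ) :
    inner ℂ f (conjKernel H z) = star (zeroExtend U f (star z)) := by
  unfold conjKernel zeroExtend
  split_ifs with h
  · rw [← inner_kernelVec, ← inner_conj_symm]; rfl
  · simp

theorem differentiableOn_conjKernel (hol : ∀ f : H, DifferentiableOn ℂ (zeroExtend U f) U) :
    DifferentiableOn ℂ (conjKernel H) (star ⁻¹' (U : Set ℂ)) := by
  refine differentiableOn_of_inner (isOpen_star_preimage U) fun f z hz => ?_
  simp only [inner_conjKernel]
  have h1 : DifferentiableAt ℂ (zeroExtend U f) (star z) :=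
    (hol f).differentiableAt (U.isOpen.mem_nhds hz)
  have := h1.star_star
  simpa [Function.comp_def] using this.differentiableWithinAt

end

/-! ### The Fubini–Study angle -/

section
variable {H : Type*} [NormedAddCommGroup H] [InnerProductSpace ℂ H]

/-- The Fubini–Study angle between the complex lines spanned by `u` and `v`. -/
noncomputable def projAngle (u v : H) : ℝ := Real.arccos (‖inner ℂ u v‖ / (‖u‖ * ‖v‖))

theorem norm_inner_div_le_one (u v : H) : ‖inner ℂ u v‖ / (‖u‖ * ‖v‖) ≤ 1 :=
  div_le_one_of_le₀ (norm_inner_le_norm u v) (by positivity)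

theorem projAngle_nonneg (u v : H) : 0 ≤ projAngle u v := Real.arccos_nonneg _

theorem projAngle_le_pi_div_two (u v : H) : projAngle u v ≤ Real.pi / 2 :=
  Real.arccos_le_pi_div_two.2 (by positivity)

theorem cos_projAngle (u v : H) : Real.cos (projAngle u v) = ‖inner ℂ u v‖ / (‖u‖ * ‖v‖) :=
  Real.cos_arccos (by linarith [show 0 ≤ ‖inner ℂ u v‖ / (‖u‖ * ‖v‖) by positivity])
    (norm_inner_div_le_one u v)

theorem projAngle_comm (u v : H) : projAngle u v = projAngle v u := by
  rw [projAngle, projAngle, norm_inner_symm, mul_comm ‖u‖]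

theorem projAngle_self {u : H} (hu : u ≠ 0) : projAngle u u = 0 := by
  have : ‖u‖ ≠ 0 := norm_ne_zero_iff.2 hu
  rw [projAngle, inner_self_eq_norm_sq_to_K]
  simp [sq, this]

theorem projAngle_smul_smul {c d : ℂ} (hc : c ≠ 0) (hd : d ≠ 0) (u v : H) :
    projAngle (c • u) (d • v) = projAngle u v := by
  have hc' : ‖c‖ ≠ 0 := norm_ne_zero_iff.2 hc
  have hd' : ‖d‖ ≠ 0 := norm_ne_zero_iff.2 hd
  rw [projAngle, projAngle, inner_smul_left, inner_smul_right, norm_mul, norm_mul, norm_smul,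
    norm_smul, RCLike.norm_conj, show ‖c‖ * ‖u‖ * (‖d‖ * ‖v‖) = ‖c‖ * ‖d‖ * (‖u‖ * ‖v‖) by ring,
    ← mul_assoc, mul_div_mul_left _ _ (mul_ne_zero hc' hd')]

theorem exists_norm_eq_one_mul_eq_norm (z : ℂ) : ∃ c : ℂ, ‖c‖ = 1 ∧ c * z = ‖z‖ := by
  by_cases hz : z = 0
  · exact ⟨1, by simp, by simp [hz]⟩
  · have : (‖z‖ : ℂ) ≠ 0 := by simpa using hz
    refine ⟨‖z‖ / z, by simp [hz], by field_simp⟩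

/-- Unimodular factors on u and w make their inner products with v real and nonnegative. The two
angles at v are then real angles, while the real angle between u and w can only exceed the
projective one, since Re ≤ |·|. -/
theorem projAngle_triangle_of_norm_eq_one {u v w : H} (hu : ‖u‖ = 1)
    (hw : ‖w‖ = 1) : projAngle u w ≤ projAngle u v + projAngle v w := by
  let _ : InnerProductSpace ℝ H := InnerProductSpace.rclikeToReal ℂ H
  have hre : ∀ x y : H, inner ℝ x y = (inner ℂ x y).re := fun _ _ => rfl
  obtain ⟨c, hc, hcu⟩ := exists_norm_eq_one_mul_eq_norm (inner ℂ v u)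
  obtain ⟨d, hd, hdw⟩ := exists_norm_eq_one_mul_eq_norm (inner ℂ v w)
  have hc0 : c ≠ 0 := by rintro rfl; simp at hc
  have hd0 : d ≠ 0 := by rintro rfl; simp at hd
  have hu' : ‖c • u‖ = 1 := by rw [norm_smul, hc, hu, one_mul]
  have hw' : ‖d • w‖ = 1 := by rw [norm_smul, hd, hw, one_mul]
  have h1 : projAngle u v = InnerProductGeometry.angle (c • u) v := by
    rw [projAngle_comm, projAngle, InnerProductGeometry.angle, real_inner_comm, hre,
      inner_smul_right, hcu, hu', hu, Complex.ofReal_re, mul_comm ‖v‖]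
  have h2 : projAngle v w = InnerProductGeometry.angle v (d • w) := by
    rw [projAngle, InnerProductGeometry.angle, hre, inner_smul_right, hdw, hw', hw,
      Complex.ofReal_re]
  have h3 : projAngle u w ≤ InnerProductGeometry.angle (c • u) (d • w) := by
    rw [← projAngle_smul_smul hc0 hd0, projAngle, InnerProductGeometry.angle, hre]
    exact Real.arccos_le_arccos (by
      rw [hu', hw']; simpa using Complex.re_le_norm (inner ℂ (c • u) (d • w)))
  rw [h1, h2]
  exact h3.trans (InnerProductGeometry.angle_le_angle_add_angle _ _ _)

theorem projAngle_triangle {u v w : H} (hu : u ≠ 0) (hv : v ≠ 0) (hw : w ≠ 0) :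
    projAngle u w ≤ projAngle u v + projAngle v w := by
  have aux : ∀ {x : H}, x ≠ 0 → ((‖x‖⁻¹ : ℝ) : ℂ) ≠ 0 ∧ ‖((‖x‖⁻¹ : ℝ) : ℂ) • x‖ = 1 := by
    intro x hx
    have : ‖x‖ ≠ 0 := norm_ne_zero_iff.2 hx
    exact ⟨by simpa using hx, by rw [norm_smul]; simp [this]⟩
  have := projAngle_triangle_of_norm_eq_one (v := ((‖v‖⁻¹ : ℝ) : ℂ) • v)
    (aux hu).2 (aux hw).2
  rwa [projAngle_smul_smul (aux hu).1 (aux hw).1, projAngle_smul_smul (aux hu).1 (aux hv).1,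
    projAngle_smul_smul (aux hv).1 (aux hw).1] at this

theorem sin_projAngle_nonneg (u v : H) : 0 ≤ Real.sin (projAngle u v) :=
  Real.sin_nonneg_of_nonneg_of_le_pi (projAngle_nonneg u v)
    ((projAngle_le_pi_div_two u v).trans (by linarith [Real.pi_pos]))

theorem fubiniStudyNorm_nonneg (u w : H) : 0 ≤ fubiniStudyNorm u w := by
  unfold fubiniStudyNorm; positivity

theorem fubiniStudyNorm_smul (u w : H) (c : ℂ) :
    fubiniStudyNorm u (c • w) = ‖c‖ * fubiniStudyNorm u w := by
  unfold fubiniStudyNorm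
  rw [norm_smul, inner_smul_right, norm_mul, mul_pow, mul_pow,
    show ‖u‖ ^ 2 * (‖c‖ ^ 2 * ‖w‖ ^ 2) - ‖c‖ ^ 2 * ‖inner ℂ u w‖ ^ 2
      = ‖c‖ ^ 2 * (‖u‖ ^ 2 * ‖w‖ ^ 2 - ‖inner ℂ u w‖ ^ 2) by ring,
    Real.sqrt_mul (by positivity), Real.sqrt_sq (norm_nonneg _), mul_div_assoc]

theorem fubiniStudyNorm_le (u w : H) : fubiniStudyNorm u w ≤ ‖w‖ / ‖u‖ := by
  by_cases hu : ‖u‖ = 0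
  · simp [fubiniStudyNorm, hu]
  · have : 0 < ‖u‖ := lt_of_le_of_ne (norm_nonneg _) (Ne.symm hu)
    unfold fubiniStudyNorm
    rw [div_le_div_iff₀ (by positivity) this]
    have : √(‖u‖ ^ 2 * ‖w‖ ^ 2 - ‖inner ℂ u w‖ ^ 2) ≤ ‖u‖ * ‖w‖ := by
      refine Real.sqrt_le_iff.2 ⟨by positivity, ?_⟩
      nlinarith [sq_nonneg ‖inner ℂ u w‖]
    nlinarith [norm_nonneg u]

theorem continuousAt_fubiniStudyNorm {p : H × H} (hp : p.1 ≠ 0) :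
    ContinuousAt (fun p : H × H => fubiniStudyNorm p.1 p.2) p := by
  unfold fubiniStudyNorm
  refine ContinuousAt.div (by fun_prop) (by fun_prop) ?_
  exact pow_ne_zero 2 (norm_ne_zero_iff.2 hp)

/-- Both sides come from the Gram determinant of u and v, which does not change when u is subtracted
from v. This presents the sine as the Fubini–Study length of the secant, up to a factor that tends
to 1 as v tends to u. -/
theorem sin_projAngle_eq {u v : H} (hu : u ≠ 0) (hv : v ≠ 0) :
    Real.sin (projAngle u v) = fubiniStudyNorm u (v - u) * (‖u‖ / ‖v‖) := by
  have hu' : ‖u‖ ≠ 0 := norm_ne_zero_iff.2 hu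
  have hv' : ‖v‖ ≠ 0 := norm_ne_zero_iff.2 hv
  have h := fubiniStudyNorm_smul_add u v 1 (-1) one_ne_zero
  rw [one_smul, one_smul, neg_one_smul, ← sub_eq_add_neg] at h
  rw [h, projAngle, Real.sin_arccos, fubiniStudyNorm,
    show 1 - (‖inner ℂ u v‖ / (‖u‖ * ‖v‖)) ^ 2
      = (‖u‖ ^ 2 * ‖v‖ ^ 2 - ‖inner ℂ u v‖ ^ 2) / (‖u‖ * ‖v‖) ^ 2 by field_simp,
    Real.sqrt_div' _ (by positivity), Real.sqrt_sq (by positivity)]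
  field_simp

theorem eventually_projAngle_le {α : Type*} {l : Filter α} {f : α → ℝ} (hf : Tendsto f l (𝓝 0))
    (h0 : ∀ a, 0 ≤ f a) {ε : ℝ} (hε : 0 < ε) : ∀ᶠ a in l, f a ≤ (1 + ε) * Real.sin (f a) := by
  have hd : HasDerivAt Real.sin 1 0 := by simpa using Real.hasDerivAt_sin 0
  -- The constant is chosen so that 1 − ε/(1 + ε) = 1/(1 + ε).
  have h1 := (hasDerivAt_iff_isLittleO.1 hd).def (show 0 < ε / (1 + ε) by positivity)
  filter_upwards [hf.eventually h1] with a ha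
  simp only [Real.sin_zero, sub_zero, smul_eq_mul, mul_one, Real.norm_eq_abs,
    abs_of_nonneg (h0 a)] at ha
  have := neg_le_of_abs_le ha
  have e : (1 + ε) * (ε / (1 + ε) * f a) = ε * f a := by field_simp
  have := mul_le_mul_of_nonneg_left this (show 0 ≤ 1 + ε by linarith)
  linarith

/-- The angle from the initial point grows along a curve at the rate given by the Fubini–Study
length of the velocity. -/
theorem eventually_projAngle_bounds {c : ℝ → H} {c' : H} {s : Set ℝ} {t₀ : ℝ}
    (hc : HasDerivWithinAt c c' s t₀) (h0 : ∀ t, c t ≠ 0) {ε : ℝ} (hε : 0 < ε) :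
    ∀ᶠ t in 𝓝[s] t₀,
      projAngle (c t₀) (c t) ≤ (fubiniStudyNorm (c t₀) c' + ε) * |t - t₀| ∧
      (fubiniStudyNorm (c t₀) c' - ε) * |t - t₀| ≤ Real.sin (projAngle (c t₀) (c t)) := by
  set F := fubiniStudyNorm (c t₀) c' with hF
  have hF0 : 0 ≤ F := fubiniStudyNorm_nonneg _ _
  have hcont : Tendsto c (𝓝[s] t₀) (𝓝 (c t₀)) := hc.continuousWithinAt
  have hsin : Tendsto (fun t => Real.sin (projAngle (c t₀) (c t)) / |t - t₀|) (𝓝[s \ {t₀}] t₀)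
      (𝓝 F) := by
    have h1 : Tendsto (fun t => fubiniStudyNorm (c t₀) (slope c t₀ t) * (‖c t₀‖ / ‖c t‖))
        (𝓝[s \ {t₀}] t₀) (𝓝 (F * (‖c t₀‖ / ‖c t₀‖))) := by
      refine Tendsto.mul ?_ (Tendsto.div tendsto_const_nhds
        ((hcont.mono_left (nhdsWithin_mono _ sdiff_subset)).norm) (norm_ne_zero_iff.2 (h0 _)))
      have h2 : Tendsto (fun t => (c t₀, slope c t₀ t)) (𝓝[s \ {t₀}] t₀) (𝓝 (c t₀, c')) :=
        tendsto_const_nhds.prodMk_nhds (hasDerivWithinAt_iff_tendsto_slope.1 hc)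
      have h3 := continuousAt_fubiniStudyNorm (p := (c t₀, c')) (h0 t₀)
      exact Tendsto.comp (f := fun t => (c t₀, slope c t₀ t)) h3 h2
    rw [div_self (norm_ne_zero_iff.2 (h0 _)), mul_one] at h1
    refine h1.congr' ?_
    filter_upwards [self_mem_nhdsWithin] with t ht
    have : t - t₀ ≠ 0 := sub_ne_zero.2 ht.2
    rw [sin_projAngle_eq (h0 _) (h0 _), slope_def_module,
      show (t - t₀)⁻¹ • (c t - c t₀) = (((t - t₀)⁻¹ : ℝ) : ℂ) • (c t - c t₀) by
        rw [Complex.coe_smul], fubiniStudyNorm_smul, Complex.norm_real, norm_inv,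
      Real.norm_eq_abs]
    ring
  have hang : Tendsto (fun t => projAngle (c t₀) (c t)) (𝓝[s] t₀) (𝓝 0) := by
    rw [← projAngle_self (h0 t₀)]
    unfold projAngle
    refine (Real.continuous_arccos.tendsto _).comp (Tendsto.div ?_ ?_ ?_)
    · exact ((tendsto_const_nhds (x := c t₀)).inner hcont).norm
    · exact tendsto_const_nhds.mul hcont.norm
    · have := norm_ne_zero_iff.2 (h0 t₀); positivity
  have hsmall : ∀ᶠ t in 𝓝[s \ {t₀}] t₀,
      projAngle (c t₀) (c t) ≤ (F + ε) * |t - t₀| ∧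
      (F - ε) * |t - t₀| ≤ Real.sin (projAngle (c t₀) (c t)) := by
    -- Passing from the sine to the angle costs a factor 1 + η, absorbed by (1 + η)(F + ε/2) ≤ F +
    -- ε.
    set η := ε / (2 * (F + ε)) with hη
    have hη0 : 0 < η := by positivity
    have e1 : (1 + η) * (F + ε / 2) ≤ F + ε := by
      have : η * (F + ε / 2) ≤ ε / 2 := by
        rw [hη, div_mul_eq_mul_div, div_le_iff₀ (by positivity)]; nlinarith
      linarith
    filter_upwards [hsin.eventually (gt_mem_nhds (show F < F + ε / 2 by linarith)),
      hsin.eventually (lt_mem_nhds (show F - ε < F by linarith)), self_mem_nhdsWithin,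
      (eventually_projAngle_le hang (fun _ => projAngle_nonneg _ _) hη0).filter_mono
        (nhdsWithin_mono _ sdiff_subset)] with t h1 h2 ht h3
    have : 0 < |t - t₀| := abs_pos.2 (sub_ne_zero.2 ht.2)
    rw [div_lt_iff₀ this] at h1
    rw [lt_div_iff₀ this] at h2
    refine ⟨h3.trans ?_, h2.le⟩
    nlinarith
  rw [nhdsWithin, eventually_inf_principal] at hsmall ⊢
  filter_upwards [hsmall] with t ht hts
  by_cases h : t = t₀
  · subst h; simp [projAngle_self (h0 t)]
  · exact ht ⟨hts, h⟩

end

/-! ### Interval functions and lengths of curves -/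

/-- A subadditive interval function which is, near each point, dominated by a superadditive one
on the intervals that begin or end at this point is dominated by it globally. -/
theorem le_of_locally_le {A B : ℝ → ℝ → ℝ≥0∞} {a b : ℝ} (hab : a ≤ b)
    (hA : ∀ r s t, a ≤ r → r ≤ s → s ≤ t → t ≤ b → A r t ≤ A r s + A s t)
    (hB : ∀ r s t, a ≤ r → r ≤ s → s ≤ t → t ≤ b → B r s + B s t ≤ B r t)
    (h : ∀ t₀ ∈ Icc a b, ∀ᶠ t in 𝓝[Icc a b] t₀,
      (t₀ ≤ t → A t₀ t ≤ B t₀ t) ∧ (t ≤ t₀ → A t t₀ ≤ B t t₀)) : A a b ≤ B a b := by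
  -- The supremum c of S lies in S by the local bound on intervals ending at c; if c < b, the bound
  -- on intervals beginning at c would push S past c.
  set S := {t | t ∈ Icc a b ∧ A a t ≤ B a t} with hS
  have haS : a ∈ S :=
    ⟨left_mem_Icc.2 hab,
      ((h a (left_mem_Icc.2 hab)).self_of_nhdsWithin (left_mem_Icc.2 hab)).1 le_rfl⟩
  have hbdd : BddAbove S := ⟨b, fun t ht => ht.1.2⟩
  have hcI : sSup S ∈ Icc a b := ⟨le_csSup hbdd haS, csSup_le ⟨a, haS⟩ fun t ht => ht.1.2⟩
  set c := sSup S with hc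
  obtain ⟨ε, hε, hloc⟩ := Metric.mem_nhdsWithin_iff.1 (h c hcI)
  have hloc' : ∀ t ∈ Icc a b, |t - c| < ε →
      (c ≤ t → A c t ≤ B c t) ∧ (t ≤ c → A t c ≤ B t c) :=
    fun t ht htc => hloc ⟨by rwa [Metric.mem_ball, Real.dist_eq], ht⟩
  have hcS : A a c ≤ B a c := by
    obtain ⟨s, hs, hsc⟩ := exists_lt_of_lt_csSup ⟨a, haS⟩ (show c - ε < sSup S by linarith)
    have hsc' : s ≤ c := le_csSup hbdd hs
    refine (hA a s c le_rfl hs.1.1 hsc' hcI.2).trans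
      (le_trans (add_le_add hs.2 ?_) (hB a s c le_rfl hs.1.1 hsc' hcI.2))
    exact (hloc' s hs.1 (by rw [abs_lt]; constructor <;> linarith)).2 hsc'
  rcases hcI.2.eq_or_lt with hcb | hcb
  · rwa [hcb] at hcS
  · exfalso
    have hct : c < min b (c + ε / 2) := lt_min hcb (by linarith)
    have htI : min b (c + ε / 2) ∈ Icc a b := ⟨hcI.1.trans hct.le, min_le_left _ _⟩
    have := le_csSup hbdd (show min b (c + ε / 2) ∈ S from ⟨htI, ?_⟩)
    · exact absurd this (not_le.2 hct)
    refine (hA a c _ le_rfl hcI.1 hct.le htI.2).trans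
      (le_trans (add_le_add hcS ?_) (hB a c _ le_rfl hcI.1 hct.le htI.2))
    refine (hloc' _ htI ?_).1 hct.le
    rw [abs_of_pos (sub_pos.2 hct)]
    linarith [min_le_right b (c + ε / 2)]

section
variable {Y : Type*} {σ σ' : Y → Y → ℝ≥0∞} {γ γ' : ℝ → Y} {a b : ℝ}

theorem sum_le_curveLength (σ : Y → Y → ℝ≥0∞) (γ : ℝ → Y) {t : ℕ → ℝ} (ht : Monotone t) (n : ℕ) :
    ∑ i ∈ Finset.range n, σ (γ (t i)) (γ (t (i + 1))) ≤ curveLength σ γ (t 0) (t n) :=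
  le_iSup_of_le n (le_iSup_of_le t (le_iSup_of_le ⟨ht, rfl, rfl⟩ le_rfl))

theorem curveLength_le {C : ℝ≥0∞} (h : ∀ (n : ℕ) (t : ℕ → ℝ), Monotone t → t 0 = a → t n = b →
    ∑ i ∈ Finset.range n, σ (γ (t i)) (γ (t (i + 1))) ≤ C) : curveLength σ γ a b ≤ C :=
  iSup_le fun n => iSup_le fun t => iSup_le fun ht => h n t ht.1 ht.2.1 ht.2.2

theorem exists_partition (hab : a ≤ b) :
    ∃ (n : ℕ) (t : ℕ → ℝ), Monotone t ∧ t 0 = a ∧ t n = b :=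
  ⟨1, fun i => if i = 0 then a else b, monotone_nat_of_le_succ fun i => by
    by_cases hi : i = 0 <;> simp [hi, hab], by simp, by simp⟩

theorem le_curveLength (hab : a ≤ b) : σ (γ a) (γ b) ≤ curveLength σ γ a b := by
  have ht : Monotone fun i : ℕ => if i = 0 then a else b := by
    refine monotone_nat_of_le_succ fun i => ?_
    by_cases hi : i = 0 <;> simp [hi, hab]
  simpa using sum_le_curveLength σ γ ht 1

theorem curveLength_mono (h : ∀ x y, σ x y ≤ σ' x y) : curveLength σ γ a b ≤ curveLength σ' γ a b :=
  curveLength_le fun n _ ht h0 hn =>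
    (Finset.sum_le_sum fun _ _ => h _ _).trans (h0 ▸ hn ▸ sum_le_curveLength σ' γ ht n)

theorem curveLength_congr (h : EqOn γ γ' (Icc a b)) :
    curveLength σ γ a b ≤ curveLength σ γ' a b := by
  refine curveLength_le fun n t ht h0 hn => ?_
  have hmem : ∀ i ≤ n, t i ∈ Icc a b := fun i hi => ⟨h0 ▸ ht (Nat.zero_le i), hn ▸ ht hi⟩
  rw [Finset.sum_congr rfl fun i hi => by
    rw [h (hmem i (Finset.mem_range.1 hi).le), h (hmem (i + 1) (Finset.mem_range.1 hi))]]
  exact h0 ▸ hn ▸ sum_le_curveLength σ γ' ht n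

theorem curveLength_comp_le {φ : ℝ → ℝ} (hφ : Monotone φ) :
    curveLength σ (γ ∘ φ) a b ≤ curveLength σ γ (φ a) (φ b) :=
  curveLength_le fun n t ht h0 hn => by
    subst h0 hn
    exact sum_le_curveLength σ γ (hφ.comp ht) n

theorem curveLength_add_le {r s t : ℝ} (hrs : r ≤ s) (hst : s ≤ t) :
    curveLength σ γ r s + curveLength σ γ s t ≤ curveLength σ γ r t := by
  have key : ∀ (n : ℕ) (u : ℕ → ℝ), Monotone u ∧ u 0 = r ∧ u n = s →
      ∀ (m : ℕ) (v : ℕ → ℝ), Monotone v ∧ v 0 = s ∧ v m = t →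
      ∑ i ∈ Finset.range n, σ (γ (u i)) (γ (u (i + 1))) +
        ∑ i ∈ Finset.range m, σ (γ (v i)) (γ (v (i + 1))) ≤ curveLength σ γ r t := by
    intro n u hu m v hv
    set w : ℕ → ℝ := fun i => if i ≤ n then u i else v (i - n) with hw
    have hwl : ∀ i ≤ n, w i = u i := fun i hi => if_pos hi
    have hwr : ∀ i, w (n + i) = v i := by
      intro i
      rcases Nat.eq_zero_or_pos i with rfl | hi
      · rw [Nat.add_zero, hwl n le_rfl, hu.2.2, hv.2.1]
      · simp [hw, show ¬ n + i ≤ n by omega]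
    have hmono : Monotone w := by
      refine monotone_nat_of_le_succ fun i => ?_
      rcases lt_or_ge i n with hi | hi
      · rw [hwl i hi.le, hwl (i + 1) hi]; exact hu.1 (Nat.le_succ i)
      · obtain ⟨j, rfl⟩ := Nat.exists_eq_add_of_le hi
        rw [hwr, Nat.add_assoc, hwr]; exact hv.1 (Nat.le_succ j)
    have := sum_le_curveLength σ γ hmono (n + m)
    rw [Finset.sum_range_add, hwr, hwl 0 (Nat.zero_le _), hu.2.1, hv.2.2] at this
    refine le_trans (le_of_eq ?_) this
    congr 1
    · refine Finset.sum_congr rfl fun i hi => ?_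
      rw [hwl i (Finset.mem_range.1 hi).le, hwl (i + 1) (Finset.mem_range.1 hi)]
    · refine Finset.sum_congr rfl fun i _ => ?_
      rw [hwr, Nat.add_assoc, hwr]
  -- Sequences that are not partitions contribute 0 to the suprema; these fixed partitions replace
  -- them so that `key` applies.
  obtain ⟨n₀, u₀, h₀⟩ := exists_partition hrs
  obtain ⟨m₁, v₁, h₁⟩ := exists_partition hst
  rw [curveLength, ENNReal.iSup_add]
  refine iSup_le fun n => ?_
  rw [ENNReal.iSup_add]
  refine iSup_le fun u => ?_
  by_cases hu : Monotone u ∧ u 0 = r ∧ u n = s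
  · rw [iSup_pos hu, curveLength, ENNReal.add_iSup]
    refine iSup_le fun m => ?_
    rw [ENNReal.add_iSup]
    refine iSup_le fun v => ?_
    by_cases hv : Monotone v ∧ v 0 = s ∧ v m = t
    · rw [iSup_pos hv]; exact key n u hu m v hv
    · rw [iSup_neg hv, bot_eq_zero, add_zero]
      exact le_self_add.trans (key n u hu m₁ v₁ h₁)
  · rw [iSup_neg hu, bot_eq_zero, zero_add]
    exact curveLength_le fun m v hv hv0 hvm =>
      le_add_self.trans (key n₀ u₀ h₀ m v ⟨hv, hv0, hvm⟩)

/-- The length is bounded by every superadditive interval function which dominates the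
distances along the curve. -/
theorem curveLength_le_of_superadditive {m : ℝ → ℝ → ℝ≥0∞}
    (hm : ∀ r s t, a ≤ r → r ≤ s → s ≤ t → t ≤ b → m r s + m s t ≤ m r t)
    (h : ∀ s t, a ≤ s → s ≤ t → t ≤ b → σ (γ s) (γ t) ≤ m s t) :
    curveLength σ γ a b ≤ m a b := by
  refine curveLength_le fun n t ht h0 hn => ?_
  have : ∀ k ≤ n, ∑ i ∈ Finset.range k, σ (γ (t i)) (γ (t (i + 1))) ≤ m (t 0) (t k) := by
    intro k
    induction k with
    | zero => simp
    | succ k ih =>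
      intro hk
      rw [Finset.sum_range_succ]
      have h1 : a ≤ t 0 := h0.ge
      have h2 : t (k + 1) ≤ b := hn ▸ ht hk
      have h3 : t k ≤ t (k + 1) := ht (Nat.le_succ k)
      have h4 : t 0 ≤ t k := ht (Nat.zero_le k)
      exact (add_le_add (ih (by omega)) (h _ _ (h1.trans h4) h3 h2)).trans
        (hm _ _ _ h1 h4 h3 h2)
  exact h0 ▸ hn ▸ this n le_rfl

end

/-! ### Wirtinger calculus and the density of ds_H² -/

section Wirtinger

/-- `f` is real differentiable at `z` with Wirtinger derivatives `α = ∂f/∂z`, `β = ∂f/∂z̄`. -/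
def HasWirtingerDerivAt (f : ℂ → ℂ) (α β z : ℂ) : Prop :=
  HasFDerivAt f (α • (1 : ℂ →L[ℝ] ℂ) + β • (Complex.conjCLE : ℂ →L[ℝ] ℂ)) z

namespace HasWirtingerDerivAt
variable {f g : ℂ → ℂ} {α β α' β' z : ℂ}

theorem wirtingerDz (h : HasWirtingerDerivAt f α β z) : wirtingerDz f z = α := by
  unfold _root_.wirtingerDz
  rw [HasFDerivAt.fderiv h]
  simp
  linear_combination (β / 2 - α / 2) * Complex.I_sq

theorem wirtingerDzbar (h : HasWirtingerDerivAt f α β z) : wirtingerDzbar f z = β := by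
  unfold _root_.wirtingerDzbar
  rw [HasFDerivAt.fderiv h]
  simp
  linear_combination (α / 2 - β / 2) * Complex.I_sq

theorem congr_of_eventuallyEq (h : HasWirtingerDerivAt f α β z) (hg : g =ᶠ[𝓝 z] f) :
    HasWirtingerDerivAt g α β z :=
  HasFDerivAt.congr_of_eventuallyEq h hg

theorem comp {F : ℂ → ℂ} {F' : ℂ} (hF : HasDerivAt F F' (f z)) (h : HasWirtingerDerivAt f α β z) :
    HasWirtingerDerivAt (fun w => F (f w)) (F' * α) (F' * β) z := by
  have := hF.comp_hasFDerivAt z h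
  refine HasFDerivAt.congr_fderiv this ?_
  ext; simp; ring

theorem mul (hf : HasWirtingerDerivAt f α β z) (hg : HasWirtingerDerivAt g α' β' z) :
    HasWirtingerDerivAt (fun w => f w * g w) (α * g z + f z * α') (β * g z + f z * β') z := by
  have := HasFDerivAt.mul hf hg
  refine HasFDerivAt.congr_fderiv this ?_
  ext; simp; ring

end HasWirtingerDerivAt

/-- Both factors are antiholomorphic in w. The inner product is conjugate linear in its first slot,
so the first factor is differentiated by ∂/∂z and the second by ∂/∂z̄. -/
theorem hasWirtingerDerivAt_inner_star {H : Type*} [NormedAddCommGroup H] [InnerProductSpace ℂ H]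
    {p q : ℂ → H} {p' q' : H} {z : ℂ} (hp : HasDerivAt p p' (star z))
    (hq : HasDerivAt q q' (star z)) :
    HasWirtingerDerivAt (fun w => inner ℂ (p (star w)) (q (star w)))
      (inner ℂ p' (q (star z))) (inner ℂ (p (star z)) q') z := by
  have aux : ∀ {P : ℂ → H} {P' : H}, HasDerivAt P P' (star z) →
      HasFDerivAt (fun w => P (star w)) ((Complex.conjCLE : ℂ →L[ℝ] ℂ).smulRight P') z := by
    intro P P' hP
    have h1 := (hP.hasFDerivAt.restrictScalars ℝ).comp z
      (Complex.conjCLE : ℂ →L[ℝ] ℂ).hasFDerivAt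
    refine h1.congr_fderiv ?_
    ext; simp
  have := (aux hp).inner ℂ (aux hq)
  refine this.congr_fderiv ?_
  ext; simp [inner_smul_left, inner_smul_right, fderivInnerCLM_apply]; ring

end Wirtinger

section
variable {U : Opens ℂ} {H : Type*} [NormedAddCommGroup H] [InnerProductSpace ℂ H]
  [CompleteSpace H] [RKHS ℂ H U ℂ]

theorem kernelVec_ne_zero (hne : ∀ x : U, ∃ h : H, h x ≠ 0) (x : U) : kernelVec H x ≠ 0 := by
  intro h0
  obtain ⟨f, hf⟩ := hne x
  exact hf (by rw [← inner_kernelVec, h0, inner_zero_left])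

variable (H) in
/-- The derivative of `z ↦ k_z` with respect to `z̄`. -/
noncomputable def kernelDeriv (z : U) : H := deriv (conjKernel H) (star (z : ℂ))

theorem hasDerivAt_conjKernel (hol : ∀ f : H, DifferentiableOn ℂ (zeroExtend U f) U) (z : U) :
    HasDerivAt (conjKernel H) (kernelDeriv H z) (star (z : ℂ)) :=
  ((differentiableOn_conjKernel hol).differentiableAt ((isOpen_star_preimage U).mem_nhds
    (by simp))).hasDerivAt

theorem hasDerivAt_deriv_conjKernel (hol : ∀ f : H, DifferentiableOn ℂ (zeroExtend U f) U)
    (z : U) :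
    HasDerivAt (deriv (conjKernel H)) (deriv (deriv (conjKernel H)) (star (z : ℂ)))
      (star (z : ℂ)) :=
  (((differentiableOn_conjKernel hol).deriv (isOpen_star_preimage U)).differentiableAt
    ((isOpen_star_preimage U).mem_nhds (by simp))).hasDerivAt

theorem wirtingerDzbar_log_kernel (hol : ∀ f : H, DifferentiableOn ℂ (zeroExtend U f) U)
    (hne : ∀ x : U, ∃ h : H, h x ≠ 0) (z : U) :
    wirtingerDzbar (zeroExtend U fun w => ((Real.log (kernelVec H w w).re : ℝ) : ℂ)) z =
      inner ℂ (conjKernel H (star (z : ℂ))) (deriv (conjKernel H) (star (z : ℂ))) *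
      (inner ℂ (conjKernel H (star (z : ℂ))) (conjKernel H (star (z : ℂ))))⁻¹ := by
  have h1 := hasWirtingerDerivAt_inner_star (hasDerivAt_conjKernel hol z)
    (hasDerivAt_conjKernel hol z)
  have hN : ∀ w : U, inner ℂ (conjKernel H (star (w : ℂ))) (conjKernel H (star (w : ℂ)))
      = ((‖kernelVec H w‖ ^ 2 : ℝ) : ℂ) := by
    intro w
    rw [conjKernel_star, inner_self_eq_norm_sq_to_K]; simp
  have h2 := HasWirtingerDerivAt.comp (Complex.hasDerivAt_log (by
    rw [hN, Complex.ofReal_mem_slitPlane]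
    have := norm_pos_iff.2 (kernelVec_ne_zero hne z)
    positivity)) h1
  rw [(h2.congr_of_eventuallyEq ?_).wirtingerDzbar, mul_comm]
  · rfl
  filter_upwards [U.isOpen.mem_nhds z.2] with w hw
  have := hN ⟨w, hw⟩
  simp only at this
  rw [this, ← Complex.ofReal_log (by positivity)]
  have hw' : w ∈ U := hw
  rw [zeroExtend, dif_pos hw', ← inner_kernelVec, inner_self_eq_norm_sq_to_K]
  norm_cast

/-- The density of the metric `ds_H²` is the square of the Fubini–Study length of the derivative
of `z ↦ [k_z]`. -/
theorem bergmanDensity_eq (hol : ∀ f : H, DifferentiableOn ℂ (zeroExtend U f) U)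
    (hne : ∀ x : U, ∃ h : H, h x ≠ 0) (z : U) :
    bergmanDensity H z = fubiniStudyNorm (kernelVec H z) (kernelDeriv H z) ^ 2 := by
  have hk : (‖kernelVec H z‖ : ℂ) ≠ 0 := by simpa using kernelVec_ne_zero hne z
  have hk' : ‖kernelVec H z‖ ≠ 0 := by simpa using kernelVec_ne_zero hne z
  have h1 := hasWirtingerDerivAt_inner_star (hasDerivAt_conjKernel hol z)
    (hasDerivAt_conjKernel hol z)
  -- The second derivative of the kernel map enters only the ∂/∂z̄ part, which is not used below.
  have h2 := hasWirtingerDerivAt_inner_star (hasDerivAt_conjKernel hol z)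
    (hasDerivAt_deriv_conjKernel hol z)
  have hN : inner ℂ (conjKernel H (star (z : ℂ))) (conjKernel H (star (z : ℂ)))
      = (‖kernelVec H z‖ : ℂ) ^ 2 := by
    rw [conjKernel_star, inner_self_eq_norm_sq_to_K]; simp
  have h3 := h2.mul (HasWirtingerDerivAt.comp (hasDerivAt_inv (by rw [hN]; exact pow_ne_zero 2 hk))
    h1)
  unfold bergmanDensity
  rw [(h3.congr_of_eventuallyEq ?_).wirtingerDz]
  · rw [hN, conjKernel_star, show deriv (conjKernel H) (star (z : ℂ)) = kernelDeriv H z from rfl,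
      ← inner_conj_symm (kernelDeriv H z) (kernelVec H z), inner_self_eq_norm_sq_to_K]
    have hnn : 0 ≤ ‖kernelVec H z‖ ^ 2 * ‖kernelDeriv H z‖ ^ 2
        - ‖inner ℂ (kernelVec H z) (kernelDeriv H z)‖ ^ 2 := by
      have := norm_inner_le_norm (𝕜 := ℂ) (kernelVec H z) (kernelDeriv H z)
      rw [← mul_pow, sub_nonneg]
      gcongr
    rw [fubiniStudyNorm, div_pow, Real.sq_sqrt hnn]
    have hm := Complex.mul_conj' (inner ℂ (kernelVec H z) (kernelDeriv H z))
    rw [← Complex.ofReal_re ((‖kernelVec H z‖ ^ 2 * ‖kernelDeriv H z‖ ^ 2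
        - ‖inner ℂ (kernelVec H z) (kernelDeriv H z)‖ ^ 2) / (‖kernelVec H z‖ ^ 2) ^ 2)]
    congr 1
    push_cast
    rw [← hm]
    simp only [Complex.coe_algebraMap]
    field_simp
    ring
  · filter_upwards [U.isOpen.mem_nhds z.2] with w hw
    exact wirtingerDzbar_log_kernel hol hne ⟨w, hw⟩

end

/-! ### Smooth curves: speed, chord angle and length -/

section
variable {U : Opens ℂ} {H : Type*} [NormedAddCommGroup H] [InnerProductSpace ℂ H]
  [CompleteSpace H] [RKHS ℂ H U ℂ]

section Density
variable (hol : ∀ f : H, DifferentiableOn ℂ (zeroExtend U f) U)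
  (hne : ∀ x : U, ∃ h : H, h x ≠ 0)
include hol hne

theorem sqrt_bergmanDensity (z : U) :
    √(bergmanDensity H z) = fubiniStudyNorm (kernelVec H z) (kernelDeriv H z) := by
  rw [bergmanDensity_eq hol hne, Real.sqrt_sq (fubiniStudyNorm_nonneg _ _)]

theorem sqrt_bergmanDensity_mul (z : U) (d : ℂ) :
    √(bergmanDensity H z) * ‖d‖ = fubiniStudyNorm (kernelVec H z) (star d • kernelDeriv H z) := by
  rw [sqrt_bergmanDensity hol hne, fubiniStudyNorm_smul, norm_star, mul_comm]

theorem continuous_sqrt_bergmanDensity : Continuous fun z : U => √(bergmanDensity H z) := by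
  simp only [sqrt_bergmanDensity hol hne]
  refine continuous_iff_continuousAt.2 fun z => ?_
  have hs : ContinuousAt (fun z : U => star (z : ℂ)) z := by fun_prop
  have h1 : ContinuousAt (fun z : U => kernelVec H z) z := by
    simp only [← conjKernel_star]
    exact ContinuousAt.comp (f := fun z : U => star (z : ℂ)) (hasDerivAt_conjKernel hol z).continuousAt hs
  have h2 : ContinuousAt (fun z : U => kernelDeriv H z) z :=
    ContinuousAt.comp (f := fun z : U => star (z : ℂ)) (hasDerivAt_deriv_conjKernel hol z).continuousAt hs
  have h3 := continuousAt_fubiniStudyNorm (p := (kernelVec H z, kernelDeriv H z))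
    (kernelVec_ne_zero hne z)
  exact ContinuousAt.comp (f := fun z : U => (kernelVec H z, kernelDeriv H z)) h3 (h1.prodMk h2)

end Density

theorem hasDerivWithinAt_kernelVec (hol : ∀ f : H, DifferentiableOn ℂ (zeroExtend U f) U)
    {γ : ℝ → U} {s : Set ℝ} {t : ℝ} {d : ℂ} (hγ : HasDerivWithinAt (fun τ => (γ τ : ℂ)) d s t) :
    HasDerivWithinAt (fun τ => kernelVec H (γ τ)) (star d • kernelDeriv H (γ t)) s t := by
  simp only [← conjKernel_star]
  exact (hasDerivAt_conjKernel hol (γ t)).scomp_hasDerivWithinAt t hγ.star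

section Curves
variable {γ : ℝ → U} {a b : ℝ} {r : ℕ∞}

theorem IsSmoothCurve.hasDerivWithinAt (hγ : IsSmoothCurve r γ a b) (hr : 1 ≤ r) {t : ℝ}
    (ht : t ∈ Icc a b) : HasDerivWithinAt (fun τ => (γ τ : ℂ))
      (derivWithin (fun τ => (γ τ : ℂ)) (Icc a b) t) (Icc a b) t :=
  ((hγ.differentiableOn (by exact_mod_cast (zero_lt_one.trans_le hr).ne')) t ht).hasDerivWithinAt

theorem IsSmoothCurve.mono (hγ : IsSmoothCurve r γ a b) {s t : ℝ} (hs : a ≤ s) (ht : t ≤ b) :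
    IsSmoothCurve r γ s t :=
  ContDiffOn.mono hγ (Icc_subset_Icc hs ht)

theorem IsSmoothCurve.continuousOn (hγ : IsSmoothCurve r γ a b) : ContinuousOn γ (Icc a b) :=
  continuousOn_iff_continuous_domRestrict.2 (Continuous.subtype_mk
    (continuousOn_iff_continuous_domRestrict.1 (ContDiffOn.continuousOn hγ)) fun t => (γ t).2)

/-- `derivWithin` depends on the interval only at its end points, a null set, so all subintervals
can share the speed computed on [a, b]. -/
theorem bergmanLength_eq_setLIntegral (γ : ℝ → U) {s t : ℝ} (hs : a ≤ s) (ht : t ≤ b) :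
    bergmanLength H γ s t = ∫⁻ τ in Ioc s t, ENNReal.ofReal
      (√(bergmanDensity H (γ τ)) * ‖derivWithin (fun u => (γ u : ℂ)) (Icc a b) τ‖) := by
  rw [bergmanLength, setLIntegral_congr Ioo_ae_eq_Icc.symm, setLIntegral_congr Ioo_ae_eq_Ioc.symm]
  refine setLIntegral_congr_fun measurableSet_Ioo fun τ hτ => ?_
  rw [derivWithin_of_mem_nhds (Icc_mem_nhds hτ.1 hτ.2),
    derivWithin_of_mem_nhds (Icc_mem_nhds (hs.trans_lt hτ.1) (hτ.2.trans_le ht))]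

theorem bergmanLength_add (γ : ℝ → U) {s t u : ℝ} (hst : s ≤ t) (htu : t ≤ u) :
    bergmanLength H γ s t + bergmanLength H γ t u = bergmanLength H γ s u := by
  rw [bergmanLength_eq_setLIntegral γ le_rfl htu, bergmanLength_eq_setLIntegral γ hst le_rfl,
    bergmanLength_eq_setLIntegral γ le_rfl le_rfl, ← Ioc_union_Ioc_eq_Ioc hst htu,
    lintegral_union measurableSet_Ioc]
  exact Ioc_disjoint_Ioc_of_le le_rfl

variable (hol : ∀ f : H, DifferentiableOn ℂ (zeroExtend U f) U)
  (hne : ∀ x : U, ∃ h : H, h x ≠ 0) (hr : 1 ≤ r)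
include hol hne hr

theorem fubiniStudyLength_eq_bergmanLength (hab : a < b) (hγ : IsSmoothCurve r γ a b) :
    fubiniStudyLength H γ a b = bergmanLength H γ a b := by
  refine setLIntegral_congr_fun measurableSet_Icc fun t ht => ?_
  rw [(hasDerivWithinAt_kernelVec hol (hγ.hasDerivWithinAt hr ht)).derivWithin
    (uniqueDiffOn_Icc hab t ht), sqrt_bergmanDensity_mul hol hne]

theorem deltaCheckDist_eq_bergmanDist (x y : U) :
    deltaCheckDist H r x y = bergmanDist H r x y :=
  iInf_congr fun _ => iInf_congr fun h =>
    fubiniStudyLength_eq_bergmanLength hol hne hr zero_lt_one h.1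

theorem continuousOn_bergmanSpeed (hab : a < b) (hγ : IsSmoothCurve r γ a b) :
    ContinuousOn (fun t => √(bergmanDensity H (γ t)) *
      ‖derivWithin (fun u => (γ u : ℂ)) (Icc a b) t‖) (Icc a b) :=
  ((continuous_sqrt_bergmanDensity hol hne).comp_continuousOn hγ.continuousOn).mul
    (ContDiffOn.continuousOn_derivWithin hγ (uniqueDiffOn_Icc hab) (by exact_mod_cast hr)).norm

end Curves

/-! ### The distances δ and δ̂ as functions of the angle -/

section Distances

theorem norm_inner_unitKernelVec (x y : U) :
    ‖inner ℂ (unitKernelVec H x) (unitKernelVec H y)‖ =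
      Real.cos (projAngle (kernelVec H x) (kernelVec H y)) := by
  rw [cos_projAngle, unitKernelVec, unitKernelVec, inner_smul_left, inner_smul_right]
  simp
  ring

theorem deltaDist_eq (x y : U) : deltaDist H x y =
    ENNReal.ofReal (Real.sin (projAngle (kernelVec H x) (kernelVec H y))) := by
  rw [deltaDist, norm_inner_unitKernelVec, ← Real.sin_sq, Real.sqrt_sq (sin_projAngle_nonneg _ _)]

theorem deltaHatDist_eq (x y : U) : deltaHatDist H x y =
    ENNReal.ofReal (2 * Real.sin (projAngle (kernelVec H x) (kernelVec H y) / 2)) := by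
  rw [deltaHatDist, norm_inner_unitKernelVec, Real.sin_half_eq_sqrt (projAngle_nonneg _ _)
    (by linarith [projAngle_le_pi_div_two (kernelVec H x) (kernelVec H y), Real.pi_pos]),
    Real.sqrt_div' _ zero_le_two, ← mul_div_assoc, mul_comm 2, mul_div_assoc, mul_comm (√_)]
  congr 2
  rw [eq_div_iff (by positivity), Real.mul_self_sqrt zero_le_two]

theorem deltaDist_comm (x y : U) : deltaDist H x y = deltaDist H y x := by
  rw [deltaDist_eq, deltaDist_eq, projAngle_comm]

theorem deltaDist_le_deltaHatDist (x y : U) : deltaDist H x y ≤ deltaHatDist H x y := by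
  rw [deltaDist_eq, deltaHatDist_eq]
  refine ENNReal.ofReal_le_ofReal ?_
  set θ := projAngle (kernelVec H x) (kernelVec H y) with hθ
  have h0 : 0 ≤ θ := projAngle_nonneg _ _
  have h1 : θ ≤ Real.pi / 2 := projAngle_le_pi_div_two _ _
  have h2 : 0 ≤ Real.sin (θ / 2) :=
    Real.sin_nonneg_of_nonneg_of_le_pi (by linarith) (by linarith [Real.pi_pos])
  calc Real.sin θ = 2 * Real.sin (θ / 2) * Real.cos (θ / 2) := by
        rw [← Real.sin_two_mul]; congr 1; ring
    _ ≤ 2 * Real.sin (θ / 2) * 1 := by gcongr; exact Real.cos_le_one _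
    _ = _ := mul_one _

theorem deltaHatDist_le_projAngle (x y : U) :
    deltaHatDist H x y ≤ ENNReal.ofReal (projAngle (kernelVec H x) (kernelVec H y)) := by
  rw [deltaHatDist_eq]
  refine ENNReal.ofReal_le_ofReal ?_
  have := Real.sin_le (div_nonneg (projAngle_nonneg (kernelVec H x) (kernelVec H y)) zero_le_two)
  linarith

theorem deltaHatDist_lt_projAngle {x y : U} (h : 0 < projAngle (kernelVec H x) (kernelVec H y)) :
    deltaHatDist H x y < ENNReal.ofReal (projAngle (kernelVec H x) (kernelVec H y)) := by
  rw [deltaHatDist_eq, ENNReal.ofReal_lt_ofReal_iff h]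
  linarith [Real.sin_lt (half_pos h)]

end Distances

section Comparison
variable {γ : ℝ → U} {a b : ℝ} {r : ℕ∞}
variable (hol : ∀ f : H, DifferentiableOn ℂ (zeroExtend U f) U)
  (hne : ∀ x : U, ∃ h : H, h x ≠ 0) (hr : 1 ≤ r)
include hol hne hr

/-- The speed is within ε/2 of its value F at t₀, and the angle and its sine grow at rate F up to
ε/2. The disjunction treats intervals on both sides of t₀ at once, as `le_of_locally_le` requires.
-/
theorem eventually_bergmanLength_bounds (hab : a < b) (hγ : IsSmoothCurve r γ a b) {ε : ℝ}
    (hε : 0 < ε) {t₀ : ℝ} (ht₀ : t₀ ∈ Icc a b) : ∀ᶠ t in 𝓝[Icc a b] t₀,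
      ∀ s u, (s = t₀ ∧ u = t ∨ s = t ∧ u = t₀) → s ≤ u →
        ENNReal.ofReal (projAngle (kernelVec H (γ s)) (kernelVec H (γ u))) ≤
          bergmanLength H γ s u + ENNReal.ofReal (ε * (u - s)) ∧
        bergmanLength H γ s u ≤ deltaDist H (γ s) (γ u) + ENNReal.ofReal (ε * (u - s)) := by
  set F : ℝ → ℝ := fun t => √(bergmanDensity H (γ t)) *
    ‖derivWithin (fun u => (γ u : ℂ)) (Icc a b) t‖ with hF
  obtain ⟨η, hη, hFη⟩ := Metric.continuousWithinAt_iff.1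
    (continuousOn_bergmanSpeed hol hne hr hab hγ t₀ ht₀) (ε / 2) (half_pos hε)
  have hloc := eventually_projAngle_bounds
    (hasDerivWithinAt_kernelVec (H := H) hol (hγ.hasDerivWithinAt hr ht₀))
    (fun t => kernelVec_ne_zero hne (γ t)) (half_pos hε)
  rw [← sqrt_bergmanDensity_mul hol hne] at hloc
  have hFt₀ : √(bergmanDensity H (γ t₀)) *
    ‖derivWithin (fun u => (γ u : ℂ)) (Icc a b) t₀‖ = F t₀ := rfl
  rw [hFt₀] at hloc
  filter_upwards [hloc, self_mem_nhdsWithin,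
    mem_nhdsWithin_of_mem_nhds (Metric.ball_mem_nhds t₀ hη)] with t h1 ht htη s u hsu hle
  rw [Metric.mem_ball, Real.dist_eq, abs_lt] at htη
  have hFb : ∀ τ ∈ Ioc s u, F t₀ - ε / 2 ≤ F τ ∧ F τ ≤ F t₀ + ε / 2 := by
    intro τ hτ
    have h2 : dist (F τ) (F t₀) < ε / 2 := by
      refine hFη ?_ ?_
      · rcases hsu with ⟨rfl, rfl⟩ | ⟨rfl, rfl⟩
        · exact ⟨ht₀.1.trans hτ.1.le, hτ.2.trans ht.2⟩
        · exact ⟨ht.1.trans hτ.1.le, hτ.2.trans ht₀.2⟩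
      · rw [Real.dist_eq, abs_lt]
        rcases hsu with ⟨rfl, rfl⟩ | ⟨rfl, rfl⟩ <;> constructor <;> linarith [hτ.1, hτ.2]
    rw [Real.dist_eq, abs_lt] at h2
    constructor <;> linarith
  have hs : a ≤ s := by rcases hsu with ⟨rfl, rfl⟩ | ⟨rfl, rfl⟩ <;> [exact ht₀.1; exact ht.1]
  have hu : u ≤ b := by rcases hsu with ⟨rfl, rfl⟩ | ⟨rfl, rfl⟩ <;> [exact ht.2; exact ht₀.2]
  have habs : |t - t₀| = u - s := by
    rcases hsu with ⟨rfl, rfl⟩ | ⟨rfl, rfl⟩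
    · exact abs_of_nonneg (by linarith)
    · rw [abs_sub_comm]; exact abs_of_nonneg (by linarith)
  have hang : projAngle (kernelVec H (γ t₀)) (kernelVec H (γ t)) =
      projAngle (kernelVec H (γ s)) (kernelVec H (γ u)) := by
    rcases hsu with ⟨rfl, rfl⟩ | ⟨rfl, rfl⟩
    · rfl
    · exact projAngle_comm _ _
  rw [habs, hang] at h1
  have hsub : 0 ≤ u - s := sub_nonneg.2 hle
  rw [bergmanLength_eq_setLIntegral γ hs hu, deltaDist_eq]
  have hconst : ∀ C : ℝ, ∫⁻ _ in Ioc s u, ENNReal.ofReal C = ENNReal.ofReal (C * (u - s)) := by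
    intro C
    rw [setLIntegral_const, Real.volume_Ioc, ← ENNReal.ofReal_mul' hsub]
  constructor
  · have h3 : ENNReal.ofReal ((F t₀ - ε / 2) * (u - s)) ≤ ∫⁻ τ in Ioc s u, ENNReal.ofReal (F τ) := by
      rw [← hconst]
      exact setLIntegral_mono' measurableSet_Ioc fun τ hτ =>
        ENNReal.ofReal_le_ofReal (hFb τ hτ).1
    refine le_trans ?_ (add_le_add_left h3 _)
    refine le_trans (ENNReal.ofReal_le_ofReal ?_) ENNReal.ofReal_add_le
    linarith [h1.1]
  · have h3 : ∫⁻ τ in Ioc s u, ENNReal.ofReal (F τ) ≤ ENNReal.ofReal ((F t₀ + ε / 2) * (u - s)) := by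
      rw [← hconst]
      exact setLIntegral_mono' measurableSet_Ioc fun τ hτ =>
        ENNReal.ofReal_le_ofReal (hFb τ hτ).2
    refine h3.trans (le_trans (ENNReal.ofReal_le_ofReal ?_) ENNReal.ofReal_add_le)
    linarith [h1.2]

omit hol hne hr in
theorem le_of_forall_le_add_ofReal_mul {x y : ℝ≥0∞} {c : ℝ} (hc : 0 < c)
    (h : ∀ ε : ℝ, 0 < ε → x ≤ y + ENNReal.ofReal (ε * c)) : x ≤ y := by
  refine ENNReal.le_of_forall_pos_le_add fun ε hε _ => ?_
  have := h (ε / c) (by positivity)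
  rwa [div_mul_cancel₀ _ hc.ne', ENNReal.ofReal_coe_nnreal] at this

/-- The angle is subadditive, the length additive, and so is the error ε(t − s): the local
comparison globalizes, and then ε → 0. -/
theorem projAngle_le_bergmanLength (hab : a < b) (hγ : IsSmoothCurve r γ a b) :
    ENNReal.ofReal (projAngle (kernelVec H (γ a)) (kernelVec H (γ b))) ≤ bergmanLength H γ a b := by
  refine le_of_forall_le_add_ofReal_mul (sub_pos.2 hab) fun ε hε => ?_
  refine le_of_locally_le
    (A := fun s t => ENNReal.ofReal (projAngle (kernelVec H (γ s)) (kernelVec H (γ t))))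
    (B := fun s t => bergmanLength H γ s t + ENNReal.ofReal (ε * (t - s))) hab.le ?_ ?_ ?_
  · intro s t u _ _ _ _
    rw [← ENNReal.ofReal_add (projAngle_nonneg _ _) (projAngle_nonneg _ _)]
    exact ENNReal.ofReal_le_ofReal (projAngle_triangle (kernelVec_ne_zero hne _)
      (kernelVec_ne_zero hne _) (kernelVec_ne_zero hne _))
  · intro s t u _ hst htu _
    refine le_of_eq ?_
    rw [← bergmanLength_add γ hst htu, add_add_add_comm, ← ENNReal.ofReal_add
      (mul_nonneg hε.le (sub_nonneg.2 hst)) (mul_nonneg hε.le (sub_nonneg.2 htu))]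
    congr 2; ring
  · intro t₀ ht₀
    filter_upwards [eventually_bergmanLength_bounds hol hne hr hab hγ hε ht₀] with t ht
    exact ⟨fun h => (ht _ _ (Or.inl ⟨rfl, rfl⟩) h).1, fun h => (ht _ _ (Or.inr ⟨rfl, rfl⟩) h).1⟩

theorem bergmanLength_le_curveLength (hab : a < b) (hγ : IsSmoothCurve r γ a b) :
    bergmanLength H γ a b ≤ curveLength (deltaDist H) γ a b := by
  refine le_of_forall_le_add_ofReal_mul (sub_pos.2 hab) fun ε hε => ?_
  refine le_of_locally_le (A := fun s t => bergmanLength H γ s t)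
    (B := fun s t => curveLength (deltaDist H) γ s t + ENNReal.ofReal (ε * (t - s)))
    hab.le ?_ ?_ ?_
  · intro s t u _ hst htu _
    exact (bergmanLength_add γ hst htu).ge
  · intro s t u _ hst htu _
    rw [add_add_add_comm, ← ENNReal.ofReal_add
      (mul_nonneg hε.le (sub_nonneg.2 hst)) (mul_nonneg hε.le (sub_nonneg.2 htu)),
      show ε * (t - s) + ε * (u - t) = ε * (u - s) by ring]
    exact add_le_add_left (curveLength_add_le hst htu) _
  · intro t₀ ht₀
    filter_upwards [eventually_bergmanLength_bounds hol hne hr hab hγ hε ht₀] with t ht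
    exact ⟨fun h => (ht _ _ (Or.inl ⟨rfl, rfl⟩) h).2.trans
        (add_le_add_left (le_curveLength h) _),
      fun h => (ht _ _ (Or.inr ⟨rfl, rfl⟩) h).2.trans (add_le_add_left (le_curveLength h) _)⟩

end Comparison

end

/-! ### Short segments issuing from a zero of a holomorphic map -/

theorem Filter.Eventually.along_segment {P : ℂ} {p : ℂ → Prop} (hp : ∀ᶠ w in 𝓝 P, p w) :
    ∀ᶠ w in 𝓝 P, ∀ t ∈ Icc (0 : ℝ) 1, p (P + t • (w - P)) := by
  obtain ⟨ε, hε, h⟩ := Metric.eventually_nhds_iff_ball.1 hp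
  filter_upwards [Metric.ball_mem_nhds P hε] with w hw t ht
  refine h _ ?_
  rw [Metric.mem_ball, dist_eq_norm] at hw ⊢
  rw [add_sub_cancel_left, norm_smul, Real.norm_eq_abs, abs_of_nonneg ht.1]
  exact (mul_le_of_le_one_left (norm_nonneg _) ht.2).trans_lt hw

/-- Near a zero `P` of a holomorphic function `W` the integral of `‖W'‖` along the segment from
`P` to `w` is almost `‖W w‖`: it has a majorant `C n tⁿ⁻¹` with `C ≤ (1 + η) ‖W w‖`. -/
theorem AnalyticAt.eventually_norm_deriv_segment_le {E : Type*} [NormedAddCommGroup E]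
    [NormedSpace ℂ E] [CompleteSpace E] {W : ℂ → E} {P : ℂ} (hW : AnalyticAt ℂ W P) (h0 : W P = 0)
    {η : ℝ} (hη : 0 < η) :
    ∀ᶠ w in 𝓝 P, ∃ (n : ℕ) (C : ℝ), 1 ≤ n ∧ 0 ≤ C ∧ C ≤ (1 + η) * ‖W w‖ ∧
      ∀ t ∈ Icc (0 : ℝ) 1, ‖w - P‖ * ‖deriv W (P + t • (w - P))‖ ≤ C * (n * t ^ (n - 1)) := by
  by_cases hz : ∀ᶠ w in 𝓝 P, W w = 0
  · have hd : ∀ᶠ w in 𝓝 P, deriv W w = 0 := by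
      filter_upwards [hz.eventually_nhds] with w hw
      rw [EventuallyEq.deriv_eq (show W =ᶠ[𝓝 w] fun _ => 0 from hw), deriv_const]
    filter_upwards [hd.along_segment] with w hw
    exact ⟨1, 0, le_rfl, le_rfl, by positivity, fun t ht => by rw [hw t ht]; simp⟩
  -- Here W = (w − P)ⁿ u, so W' = (w − P)ⁿ⁻¹ (n u + (w − P) u'). The bound M lies strictly between
  -- ‖u P‖ and (1 + η)‖u P‖, leaving room for the variation of u on either side.
  · obtain ⟨n, u, hu, hu0, hWu⟩ := hW.exists_eventuallyEq_pow_smul_nonzero_iff.2 hz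
    have hn : 1 ≤ n := by
      rw [Nat.one_le_iff_ne_zero]
      rintro rfl
      have := hWu.self_of_nhds
      simp only [sub_self, pow_zero, one_smul, h0] at this
      exact hu0 this.symm
    have hu0' : 0 < ‖u P‖ := norm_pos_iff.2 hu0
    set M := (1 + η / 2) * ‖u P‖ with hM
    have hlt : ‖u P‖ < M := by nlinarith
    have hd : ∀ᶠ w in 𝓝 P, ‖deriv W w‖ ≤ ‖w - P‖ ^ (n - 1) * (n * M) := by
      have hc : ContinuousAt (fun w => ‖(n : ℂ) • u w + (w - P) • deriv u w‖) P :=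
        ((hu.continuousAt.const_smul _).add
          ((continuousAt_id.sub continuousAt_const).smul hu.deriv.continuousAt)).norm
      have hc1 : ‖(n : ℂ) • u P + (P - P) • deriv u P‖ < n * M := by
        rw [sub_self, zero_smul, add_zero, norm_smul, Complex.norm_natCast]
        have : (0 : ℝ) < n := by exact_mod_cast hn
        exact mul_lt_mul_of_pos_left hlt this
      filter_upwards [hc.eventually (gt_mem_nhds hc1), hWu.eventually_nhds,
        hu.eventually_analyticAt] with w h1 h2 h3
      have h4 : HasDerivAt (fun z => (z - P) ^ n • u z)
          ((w - P) ^ n • deriv u w + (n * (w - P) ^ (n - 1) * 1) • u w) w :=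
        (((hasDerivAt_id w).sub_const P).pow n).smul h3.differentiableAt.hasDerivAt
      rw [EventuallyEq.deriv_eq h2, h4.deriv,
        show (w - P) ^ n • deriv u w + (n * (w - P) ^ (n - 1) * 1) • u w
          = (w - P) ^ (n - 1) • ((n : ℂ) • u w + (w - P) • deriv u w) by
          rw [smul_add, smul_smul, smul_smul, ← pow_succ, Nat.sub_add_cancel hn, add_comm]
          congr 2; ring, norm_smul, norm_pow]
      gcongr
    have hlow : ∀ᶠ w in 𝓝 P, M ≤ (1 + η) * ‖u w‖ := by
      have h1 : M < (1 + η) * ‖u P‖ := by nlinarith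
      filter_upwards [(hu.continuousAt.norm.const_mul (1 + η)).eventually (lt_mem_nhds h1)]
        with w hw using hw.le
    filter_upwards [hd.along_segment, hlow, hWu] with w h1 h2 h3
    refine ⟨n, ‖w - P‖ ^ n * M, hn, by positivity, ?_, fun t ht => ?_⟩
    · rw [h3, norm_smul, norm_pow]
      calc ‖w - P‖ ^ n * M ≤ ‖w - P‖ ^ n * ((1 + η) * ‖u w‖) := by gcongr
        _ = _ := by ring
    · have h4 := h1 t ht
      rw [add_sub_cancel_left, norm_smul, Real.norm_eq_abs, abs_of_nonneg ht.1] at h4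
      calc ‖w - P‖ * ‖deriv W (P + t • (w - P))‖
          ≤ ‖w - P‖ * ((t * ‖w - P‖) ^ (n - 1) * (n * M)) := by gcongr
        _ = ‖w - P‖ ^ (n - 1 + 1) * M * (n * t ^ (n - 1)) := by rw [mul_pow, pow_succ]; ring
        _ = _ := by rw [Nat.sub_add_cancel hn]

theorem lintegral_const_mul_pow {n : ℕ} (hn : 1 ≤ n) {C : ℝ} (hC : 0 ≤ C) :
    ∫⁻ t in Icc (0 : ℝ) 1, ENNReal.ofReal (C * (n * t ^ (n - 1))) = ENNReal.ofReal C := by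
  rw [← ofReal_integral_eq_lintegral_ofReal, integral_Icc_eq_integral_Ioc,
    ← intervalIntegral.integral_of_le zero_le_one]
  · congr 1
    rw [intervalIntegral.integral_const_mul, intervalIntegral.integral_const_mul, integral_pow,
      Nat.sub_add_cancel hn]
    have : (n : ℝ) ≠ 0 := by positivity
    have h2 : ((n - 1 : ℕ) : ℝ) + 1 = n := by rw [Nat.cast_sub hn]; simp
    rw [h2, one_pow, zero_pow (by omega), sub_zero, mul_one_div_cancel this, mul_one]
  · exact (by fun_prop : Continuous fun t : ℝ => C * (n * t ^ (n - 1))).continuousOn.integrableOn_Icc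
  · filter_upwards [ae_restrict_mem measurableSet_Icc] with t ht
    have := ht.1
    positivity

/-! ### Affine coordinates on P(H) -/

section
variable {H : Type*} [NormedAddCommGroup H] [InnerProductSpace ℂ H]

/-- The affine coordinate on `P(H)` centred at `[e]`, evaluated at `[v]`: the vector `w ⊥ e` with
`[v] = [e / ‖e‖ + w]`. -/
noncomputable def projChart (e v : H) : H :=
  ((‖e‖ : ℂ) / inner ℂ e v) • v - ((‖e‖⁻¹ : ℝ) : ℂ) • e

variable {e v : H}

theorem inner_projChart (hev : inner ℂ e v ≠ 0) : inner ℂ e (projChart e v) = 0 := by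
  have he : (‖e‖ : ℂ) ≠ 0 := by
    simp only [ne_eq, Complex.ofReal_eq_zero, norm_eq_zero]; rintro rfl; simp at hev
  rw [projChart, inner_sub_right, inner_smul_right, inner_smul_right, inner_self_eq_norm_sq_to_K]
  simp only [Complex.coe_algebraMap]
  push_cast
  field_simp
  ring

theorem one_le_norm_projChart_add (hev : inner ℂ e v ≠ 0) :
    1 ≤ ‖projChart e v + ((‖e‖⁻¹ : ℝ) : ℂ) • e‖ := by
  have he : ‖e‖ ≠ 0 := by
    simp only [ne_eq, norm_eq_zero]; rintro rfl; simp at hev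
  have h := norm_inner_le_norm (𝕜 := ℂ) e (projChart e v + ((‖e‖⁻¹ : ℝ) : ℂ) • e)
  rw [inner_add_right, inner_projChart hev, zero_add, inner_smul_right,
    inner_self_eq_norm_sq_to_K, norm_mul] at h
  simp only [Complex.coe_algebraMap, norm_pow, Complex.norm_real, norm_inv, norm_norm] at h
  rw [sq, ← mul_assoc, inv_mul_cancel₀ he, one_mul] at h
  exact le_of_mul_le_mul_left (by linarith) (lt_of_le_of_ne (norm_nonneg _) (Ne.symm he))

/-- In the right triangle with orthogonal legs e/‖e‖ and `projChart e v`, the hypotenuse represents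
[v]; the sine is the opposite leg over the hypotenuse. -/
theorem sin_projAngle_eq_norm_projChart (hev : inner ℂ e v ≠ 0) :
    Real.sin (projAngle e v) =
      ‖projChart e v‖ / ‖projChart e v + ((‖e‖⁻¹ : ℝ) : ℂ) • e‖ := by
  have he0 : e ≠ 0 := by rintro rfl; simp at hev
  have he : ‖e‖ ≠ 0 := norm_ne_zero_iff.2 he0
  have hec : (‖e‖ : ℂ) ≠ 0 := by exact_mod_cast he
  have hec' : ((‖e‖⁻¹ : ℝ) : ℂ) ≠ 0 := by exact_mod_cast inv_ne_zero he
  have h1 : ‖((‖e‖⁻¹ : ℝ) : ℂ) • e‖ = 1 := by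
    rw [norm_smul, Complex.norm_real, norm_inv, norm_norm, inv_mul_cancel₀ he]
  have hV : projChart e v + ((‖e‖⁻¹ : ℝ) : ℂ) • e = ((‖e‖ : ℂ) / inner ℂ e v) • v := by
    rw [projChart, sub_add_cancel]
  have hV0 : projChart e v + ((‖e‖⁻¹ : ℝ) : ℂ) • e ≠ 0 :=
    norm_pos_iff.1 (zero_lt_one.trans_le (one_le_norm_projChart_add hev))
  rw [← projAngle_smul_smul hec' (div_ne_zero hec hev), ← hV,
    sin_projAngle_eq (by rw [← norm_pos_iff, h1]; exact one_pos) hV0, add_sub_cancel_right, h1,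
    fubiniStudyNorm, h1, inner_smul_left, inner_projChart hev]
  simp [div_eq_mul_inv]

/-- In the affine coordinate, Fubini–Study lengths are at most Hilbert-space lengths. -/
theorem fubiniStudyNorm_le_norm_deriv_projChart {Ψ : ℂ → H} {Ψ' : H} {w : ℂ}
    (hΨ : HasDerivAt Ψ Ψ' w) (hev : inner ℂ e (Ψ w) ≠ 0) :
    fubiniStudyNorm (Ψ w) Ψ' ≤ ‖deriv (fun z => projChart e (Ψ z)) w‖ := by
  have he0 : e ≠ 0 := by rintro rfl; simp at hev
  have hec : (‖e‖ : ℂ) ≠ 0 := by exact_mod_cast norm_ne_zero_iff.2 he0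
  have hφ : HasDerivAt (fun z => inner ℂ e (Ψ z)) (inner ℂ e Ψ') w :=
    (innerSL ℂ e).hasFDerivAt.comp_hasDerivAt w hΨ
  have hq := (hasDerivAt_const w (‖e‖ : ℂ)).div hφ hev
  have hW := (hq.smul hΨ).sub_const (((‖e‖⁻¹ : ℝ) : ℂ) • e)
  have hW' : deriv (fun z => projChart e (Ψ z)) w = _ := hW.deriv
  -- The chart rescales Ψ by a function, so its derivative is cΨ' + aΨ, which represents the same
  -- tangent vector as Ψ'.
  rw [hW', ← fubiniStudyNorm_smul_add (Ψ w) Ψ' _ _ (div_ne_zero hec hev)]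
  refine (fubiniStudyNorm_le _ _).trans (div_le_self (norm_nonneg _) ?_)
  have := one_le_norm_projChart_add hev
  rwa [projChart, sub_add_cancel] at this

theorem analyticAt_projChart [CompleteSpace H] {Ψ : ℂ → H} {w : ℂ} (hΨ : AnalyticAt ℂ Ψ w)
    (hev : inner ℂ e (Ψ w) ≠ 0) : AnalyticAt ℂ (fun z => projChart e (Ψ z)) w := by
  have hφ : AnalyticAt ℂ (fun z => inner ℂ e (Ψ z)) w :=
    ((innerSL ℂ e).analyticAt _).comp hΨ
  exact ((analyticAt_const.div hφ hev).smul hΨ).sub analyticAt_const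

theorem projChart_self (he : e ≠ 0) : projChart e e = 0 := by
  have hec : (‖e‖ : ℂ) ≠ 0 := by exact_mod_cast norm_ne_zero_iff.2 he
  rw [projChart, inner_self_eq_norm_sq_to_K, sub_eq_zero]
  congr 1
  simp only [Complex.coe_algebraMap]
  push_cast
  field_simp

end

/-! ### The distance δ_BS: local comparison with δ, metric axioms, positivity -/

section
variable {U : Opens ℂ} {H : Type*} [NormedAddCommGroup H] [InnerProductSpace ℂ H]
  [CompleteSpace H] [RKHS ℂ H U ℂ]
variable {γ : ℝ → U} {a b : ℝ} {r : ℕ∞}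

theorem exists_segment_curve (r : ℕ∞) {z₀ z : U}
    (h : ∀ t ∈ Icc (0 : ℝ) 1, (z₀ : ℂ) + t • ((z : ℂ) - z₀) ∈ U) :
    ∃ γ : ℝ → U, IsSmoothCurve r γ 0 1 ∧ γ 0 = z₀ ∧ γ 1 = z ∧
      ∀ t ∈ Icc (0 : ℝ) 1, (γ t : ℂ) = (z₀ : ℂ) + t • ((z : ℂ) - z₀) ∧
        derivWithin (fun u => (γ u : ℂ)) (Icc 0 1) t = z - z₀ := by
  -- The parameter is clamped to [0, 1] because the curve must take values in `U` for all real t.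
  set γ : ℝ → U := fun t => ⟨(z₀ : ℂ) + (projIcc (0 : ℝ) 1 zero_le_one t : ℝ) • ((z : ℂ) - z₀),
    h _ (projIcc (0 : ℝ) 1 zero_le_one t).2⟩ with hγ
  have hval : ∀ t ∈ Icc (0 : ℝ) 1, (γ t : ℂ) = (z₀ : ℂ) + t • ((z : ℂ) - z₀) := by
    intro t ht
    simp [hγ, projIcc_of_mem _ ht]
  refine ⟨γ, ?_, Subtype.ext ?_, Subtype.ext ?_, fun t ht => ⟨hval t ht, ?_⟩⟩
  · refine ContDiffOn.congr ?_ hval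
    exact (contDiff_const.add (contDiff_id.smul contDiff_const)).contDiffOn
  · rw [hval 0 (by simp)]; simp
  · rw [hval 1 (by simp)]; simp
  · have hd : HasDerivAt (fun t : ℝ => (z₀ : ℂ) + t • ((z : ℂ) - z₀)) ((1 : ℝ) • ((z : ℂ) - z₀)) t :=
      ((hasDerivAt_id t).smul_const _).const_add _
    rw [derivWithin_congr hval (hval t ht),
      hd.hasDerivWithinAt.derivWithin (uniqueDiffOn_Icc zero_lt_one t ht), one_smul]

theorem bergmanDist_le_bergmanLength (hγ : IsSmoothCurve r γ 0 1) :
    bergmanDist H r (γ 0) (γ 1) ≤ bergmanLength H γ 0 1 :=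
  iInf₂_le γ ⟨hγ, rfl, rfl⟩

variable (hol : ∀ f : H, DifferentiableOn ℂ (zeroExtend U f) U)
  (hne : ∀ x : U, ∃ h : H, h x ≠ 0)
include hol hne

theorem projChart_conjKernel_facts (x : U) :
    inner ℂ (kernelVec H x) (conjKernel H (star (x : ℂ))) ≠ 0 ∧
    AnalyticAt ℂ (fun w => projChart (kernelVec H x) (conjKernel H w)) (star (x : ℂ)) ∧
    projChart (kernelVec H x) (conjKernel H (star (x : ℂ))) = 0 ∧
    ∀ᶠ w in 𝓝 (star (x : ℂ)), star w ∈ U ∧ inner ℂ (kernelVec H x) (conjKernel H w) ≠ 0 := by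
  have hx := kernelVec_ne_zero hne x
  have hx1 : inner ℂ (kernelVec H x) (conjKernel H (star (x : ℂ))) ≠ 0 := by
    rw [conjKernel_star]; exact inner_self_ne_zero.2 hx
  have hmem : (star ⁻¹' (U : Set ℂ)) ∈ 𝓝 (star (x : ℂ)) :=
    (isOpen_star_preimage U).mem_nhds (by simp)
  have hΨ : AnalyticAt ℂ (conjKernel H) (star (x : ℂ)) :=
    (differentiableOn_conjKernel hol).analyticAt hmem
  refine ⟨hx1, analyticAt_projChart hΨ hx1, ?_, ?_⟩
  · rw [conjKernel_star, projChart_self hx]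
  · filter_upwards [hmem, ((continuousAt_const (y := kernelVec H x)).inner
      hΨ.continuousAt).eventually_ne hx1] with w h1 h2 using ⟨h1, h2⟩

/-- Near a fixed point `z₀`, the length of the segment from `z₀` to `z` is almost `δ(z₀, z)`; this
includes the points `z₀` where the metric degenerates. -/
theorem eventually_bergmanDist_le (r : ℕ∞) (z₀ : U) {ε : ℝ} (hε : 0 < ε) :
    ∀ᶠ z in 𝓝 z₀, bergmanDist H r z₀ z ≤ ENNReal.ofReal (1 + ε) * deltaDist H z₀ z := by
  obtain ⟨hx1, hW, hW0, hloc⟩ := projChart_conjKernel_facts hol hne z₀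
  set e := kernelVec H z₀ with he
  have he0 : ‖e‖ ≠ 0 := norm_ne_zero_iff.2 (kernelVec_ne_zero hne z₀)
  -- One factor 1 + η is lost in the segment estimate, the other in replacing the norm of the chart
  -- by the sine of the angle.
  obtain ⟨η, hη, hη2⟩ : ∃ η : ℝ, 0 < η ∧ (1 + η) * (1 + η) ≤ 1 + ε := by
    refine ⟨min 1 (ε / 3), by positivity, ?_⟩
    nlinarith [min_le_left 1 (ε / 3), min_le_right 1 (ε / 3),
      show 0 < min 1 (ε / 3) by positivity]
  have hV : ∀ᶠ w in 𝓝 (star (z₀ : ℂ)),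
      ‖projChart e (conjKernel H w) + ((‖e‖⁻¹ : ℝ) : ℂ) • e‖ < 1 + η := by
    refine (hW.continuousAt.add continuousAt_const).norm.eventually (gt_mem_nhds ?_)
    change ‖projChart e (conjKernel H (star (z₀ : ℂ))) + ((‖e‖⁻¹ : ℝ) : ℂ) • e‖ < 1 + η
    rw [hW0, zero_add, norm_smul, Complex.norm_real, norm_inv, norm_norm, inv_mul_cancel₀ he0]
    linarith
  have hs : ContinuousAt (fun z : U => star (z : ℂ)) z₀ := by fun_prop
  filter_upwards [hs.eventually hV, hs.eventually hloc.along_segment,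
    hs.eventually (hW.eventually_norm_deriv_segment_le hW0 hη)] with z h1 h2 h3
  obtain ⟨n, C, hn, hC, hCW, hint⟩ := h3
  have hstar : ∀ t : ℝ, star (z₀ : ℂ) + t • (star (z : ℂ) - star (z₀ : ℂ)) =
      star ((z₀ : ℂ) + t • ((z : ℂ) - z₀)) := by
    intro t; simp
  simp only [hstar, star_star] at h2 hint
  obtain ⟨γ, hγ, hγ0, hγ1, hγv⟩ := exists_segment_curve r fun t ht => (h2 t ht).1
  have hev : inner ℂ e (kernelVec H z) ≠ 0 := by
    have := (h2 1 (by simp)).2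
    rwa [one_smul, add_sub_cancel, conjKernel_star] at this
  calc bergmanDist H r z₀ z ≤ bergmanLength H γ 0 1 := by
        rw [← hγ0, ← hγ1]; exact bergmanDist_le_bergmanLength hγ
    _ ≤ ∫⁻ t in Icc (0 : ℝ) 1, ENNReal.ofReal (C * (n * t ^ (n - 1))) := by
        refine setLIntegral_mono' measurableSet_Icc fun t ht => ENNReal.ofReal_le_ofReal ?_
        refine le_trans ?_ (hint t ht)
        rw [(hγv t ht).2, ← star_sub, norm_star, mul_comm, sqrt_bergmanDensity hol hne,
          ← (hγv t ht).1, ← conjKernel_star]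
        refine mul_le_mul_of_nonneg_left ?_ (norm_nonneg _)
        refine fubiniStudyNorm_le_norm_deriv_projChart (hasDerivAt_conjKernel hol (γ t)) ?_
        rw [(hγv t ht).1]
        exact (h2 t ht).2
    _ = ENNReal.ofReal C := lintegral_const_mul_pow hn hC
    _ ≤ ENNReal.ofReal ((1 + ε) * Real.sin (projAngle e (kernelVec H z))) := by
        refine ENNReal.ofReal_le_ofReal (hCW.trans ?_)
        rw [sin_projAngle_eq_norm_projChart hev, ← mul_div_assoc,
          le_div_iff₀ (zero_lt_one.trans_le (one_le_norm_projChart_add hev))]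
        rw [conjKernel_star] at h1 ⊢
        calc _ ≤ (1 + η) * ‖projChart e (kernelVec H z)‖ * (1 + η) := by gcongr
          _ = (1 + η) * (1 + η) * ‖projChart e (kernelVec H z)‖ := by ring
          _ ≤ _ := by gcongr
    _ = _ := by rw [deltaDist_eq, ENNReal.ofReal_mul (by positivity)]

omit hol in
theorem deltaDist_self (x : U) : deltaDist H x x = 0 := by
  have := kernelVec_ne_zero (H := H) hne x
  rw [deltaDist_eq, projAngle_self this]; simp

theorem bergmanDist_self (x : U) : bergmanDist H r x x = 0 := by
  have := (eventually_bergmanDist_le hol hne r x one_pos).self_of_nhds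
  rwa [deltaDist_self hne, mul_zero, nonpos_iff_eq_zero] at this

variable (hr : 1 ≤ r)
include hr

theorem projAngle_le_bergmanDist (x y : U) :
    ENNReal.ofReal (projAngle (kernelVec H x) (kernelVec H y)) ≤ bergmanDist H r x y := by
  refine le_iInf₂ fun γ hγ => ?_
  obtain ⟨hγ, rfl, rfl⟩ := hγ
  exact projAngle_le_bergmanLength hol hne hr zero_lt_one hγ

theorem deltaHatDist_le_bergmanDist (x y : U) : deltaHatDist H x y ≤ bergmanDist H r x y :=
  (deltaHatDist_le_projAngle x y).trans (projAngle_le_bergmanDist hol hne hr x y)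

theorem curveLength_deltaDist_eq (hab : a < b) (hγ : IsSmoothCurve r γ a b) :
    curveLength (deltaDist H) γ a b = bergmanLength H γ a b := by
  refine le_antisymm (curveLength_le_of_superadditive (m := bergmanLength H γ) ?_ ?_)
    (bergmanLength_le_curveLength hol hne hr hab hγ)
  · exact fun s t u _ hst htu _ => (bergmanLength_add γ hst htu).le
  · intro s t hs hst ht
    rcases hst.eq_or_lt with rfl | hst
    · simp [deltaDist_self hne]
    · exact (deltaDist_le_deltaHatDist _ _).trans ((deltaHatDist_le_projAngle _ _).trans
        (projAngle_le_bergmanLength hol hne hr hst (hγ.mono hs ht)))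

/-- Invariance of the length under reparametrization is read off from ℓ_δ, where it is a matter of
partitions, so no change of variables is needed. -/
theorem bergmanDist_le_bergmanLength_of_lt (hab : a < b) (hγ : IsSmoothCurve r γ a b) :
    bergmanDist H r (γ a) (γ b) ≤ bergmanLength H γ a b := by
  set φ : ℝ → ℝ := fun t => a + t * (b - a) with hφ
  have hba : 0 < b - a := sub_pos.2 hab
  have hmono : Monotone φ := fun s t hst => by simp only [hφ]; gcongr
  have h0 : φ 0 = a := by simp [hφ]
  have h1 : φ 1 = b := by simp [hφ]
  have hs : IsSmoothCurve r (γ ∘ φ) 0 1 := by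
    refine ContDiffOn.comp (g := fun s => (γ s : ℂ)) (t := Icc a b) hγ ?_ ?_
    · exact (contDiff_const.add (contDiff_id.mul contDiff_const)).contDiffOn
    · intro t ht
      rw [← h0, ← h1]
      exact ⟨hmono ht.1, hmono ht.2⟩
  have h2 := bergmanDist_le_bergmanLength (H := H) hs
  rw [← curveLength_deltaDist_eq hol hne hr zero_lt_one hs] at h2
  have h3 := h2.trans (curveLength_comp_le hmono)
  simp only [Function.comp, h0, h1] at h3
  rwa [curveLength_deltaDist_eq hol hne hr hab hγ] at h3

theorem curveLength_bergmanDist_eq (hab : a < b) (hγ : IsSmoothCurve r γ a b) :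
    curveLength (bergmanDist H r) γ a b = bergmanLength H γ a b := by
  refine le_antisymm (curveLength_le_of_superadditive (m := bergmanLength H γ) ?_ ?_) ?_
  · exact fun s t u _ hst htu _ => (bergmanLength_add γ hst htu).le
  · intro s t hs hst ht
    rcases hst.eq_or_lt with rfl | hst
    · simp [bergmanDist_self hol hne]
    · exact bergmanDist_le_bergmanLength_of_lt hol hne hr hst (hγ.mono hs ht)
  · rw [← curveLength_deltaDist_eq hol hne hr hab hγ]
    exact curveLength_mono fun x y =>
      (deltaDist_le_deltaHatDist x y).trans (deltaHatDist_le_bergmanDist hol hne hr x y)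

theorem bergmanDist_le_swap (x y : U) : bergmanDist H r y x ≤ bergmanDist H r x y := by
  refine le_iInf₂ fun γ hγ => ?_
  obtain ⟨hγ, rfl, rfl⟩ := hγ
  set ρ : ℝ → U := fun t => γ (1 - t) with hρ
  have hs : IsSmoothCurve r ρ 0 1 := by
    refine ContDiffOn.comp (g := fun s => (γ s : ℂ)) (t := Icc 0 1) hγ ?_ ?_
    · exact (contDiff_const.sub contDiff_id).contDiffOn
    · intro t ht
      exact ⟨by linarith [ht.2], by linarith [ht.1]⟩
  have h2 := bergmanDist_le_bergmanLength (H := H) hs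
  simp only [hρ, sub_zero, sub_self] at h2
  refine h2.trans ?_
  rw [← curveLength_deltaDist_eq hol hne hr zero_lt_one hs,
    ← curveLength_deltaDist_eq hol hne hr zero_lt_one hγ]
  refine curveLength_le fun n t ht h0 hn => ?_
  -- The reversed partition; with the symmetry of δ it gives the same sum.
  have hmono : Monotone fun i => 1 - t (n - i) := fun i j hij =>
    sub_le_sub_left (ht (Nat.sub_le_sub_left hij n)) _
  have := sum_le_curveLength (deltaDist H) γ hmono n
  simp only [Nat.sub_zero, Nat.sub_self, h0, hn, sub_self, sub_zero] at this
  refine le_trans (le_of_eq ?_) this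
  rw [← Finset.sum_range_reflect]
  refine Finset.sum_congr rfl fun i hi => ?_
  have hi := Finset.mem_range.1 hi
  rw [deltaDist_comm, show n - 1 - i + 1 = n - i by omega, show n - 1 - i = n - (i + 1) by omega]

theorem bergmanDist_comm (x y : U) : bergmanDist H r x y = bergmanDist H r y x :=
  le_antisymm (bergmanDist_le_swap hol hne hr y x) (bergmanDist_le_swap hol hne hr x y)

theorem bergmanDist_triangle (x y z : U) :
    bergmanDist H r x z ≤ bergmanDist H r x y + bergmanDist H r y z := by
  rw [bergmanDist.eq_1 H r x y, ENNReal.iInf_add]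
  refine le_iInf fun γ₁ => ?_
  rw [ENNReal.iInf_add]
  refine le_iInf fun ⟨h₁, hx, hy⟩ => ?_
  rw [bergmanDist.eq_1 H r y z, ENNReal.add_iInf]
  refine le_iInf fun γ₂ => ?_
  rw [ENNReal.add_iInf]
  refine le_iInf fun ⟨h₂, hy', hz⟩ => ?_
  -- After these reparametrizations the first curve rests at y from time 1/3 on and the second rests
  -- there until 2/3, so the concatenation is smooth across the overlap. Its length is again
  -- controlled through ℓ_δ.
  set φ₁ : ℝ → ℝ := fun t => Real.smoothTransition (3 * t) with hφ₁
  set φ₂ : ℝ → ℝ := fun t => Real.smoothTransition (3 * t - 2) with hφ₂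
  set γ : ℝ → U := fun t => if t ≤ 1 / 2 then γ₁ (φ₁ t) else γ₂ (φ₂ t) with hγ
  have hl : ∀ t < 2 / 3, γ t = γ₁ (φ₁ t) := by
    intro t ht
    by_cases h : t ≤ 1 / 2
    · exact if_pos h
    · rw [hγ]
      simp only [if_neg h, hφ₁, hφ₂]
      rw [Real.smoothTransition.zero_of_nonpos (by linarith),
        Real.smoothTransition.one_of_one_le (by linarith), hy, hy']
  have hg : ∀ t > 1 / 3, γ t = γ₂ (φ₂ t) := by
    intro t ht
    by_cases h : t ≤ 1 / 2
    · rw [hγ]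
      simp only [if_pos h, hφ₁, hφ₂]
      rw [Real.smoothTransition.one_of_one_le (by linarith),
        Real.smoothTransition.zero_of_nonpos (by linarith), hy, hy']
    · exact if_neg h
  have hmono₁ : Monotone φ₁ := fun s t hst => Real.smoothTransition.monotone (by linarith)
  have hmono₂ : Monotone φ₂ := fun s t hst => Real.smoothTransition.monotone (by linarith)
  have aux : ∀ {γ' : ℝ → U} {φ : ℝ → ℝ}, IsSmoothCurve r γ' 0 1 → ContDiff ℝ r φ →
      (∀ t, φ t ∈ Icc (0 : ℝ) 1) → ContDiff ℝ r fun t => (γ' (φ t) : ℂ) := by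
    intro γ' φ h hφ hm
    rw [← contDiffOn_univ]
    exact ContDiffOn.comp (g := fun s => (γ' s : ℂ)) (t := Icc 0 1) h hφ.contDiffOn fun t _ => hm t
  have hs₁ : ContDiff ℝ r fun t => (γ₁ (φ₁ t) : ℂ) :=
    aux h₁ (Real.smoothTransition.contDiff.comp (contDiff_const.mul contDiff_id))
      fun t => ⟨Real.smoothTransition.nonneg _, Real.smoothTransition.le_one _⟩
  have hs₂ : ContDiff ℝ r fun t => (γ₂ (φ₂ t) : ℂ) :=
    aux h₂ (Real.smoothTransition.contDiff.comp
      ((contDiff_const.mul contDiff_id).sub contDiff_const))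
      fun t => ⟨Real.smoothTransition.nonneg _, Real.smoothTransition.le_one _⟩
  have hs : IsSmoothCurve r γ 0 1 := by
    refine ContDiff.contDiffOn (contDiff_iff_contDiffAt.2 fun t => ?_)
    rcases lt_or_ge t (1 / 2) with h | h
    · refine hs₁.contDiffAt.congr_of_eventuallyEq ?_
      filter_upwards [gt_mem_nhds (show t < 2 / 3 by linarith)] with s hs
      rw [hl s hs]
    · refine hs₂.contDiffAt.congr_of_eventuallyEq ?_
      filter_upwards [lt_mem_nhds (show 1 / 3 < t by linarith)] with s hs
      rw [hg s hs]
  have e1 : φ₁ 0 = 0 := by simp [hφ₁]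
  have e2 : φ₁ (1 / 2) = 1 := Real.smoothTransition.one_of_one_le (by norm_num)
  have e3 : φ₂ (1 / 2) = 0 := Real.smoothTransition.zero_of_nonpos (by norm_num)
  have e4 : φ₂ 1 = 1 := Real.smoothTransition.one_of_one_le (by norm_num)
  have b0 : γ 0 = x := by rw [hl 0 (by norm_num), e1, hx]
  have b1 : γ 1 = z := by rw [hg 1 (by norm_num), e4, hz]
  have hmain := bergmanDist_le_bergmanLength (H := H) hs
  rw [b0, b1, ← bergmanLength_add γ (show (0 : ℝ) ≤ 1 / 2 by norm_num) (by norm_num)] at hmain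
  refine hmain.trans (add_le_add ?_ ?_)
  · rw [← curveLength_deltaDist_eq hol hne hr (by norm_num) (hs.mono le_rfl (by norm_num)),
      ← curveLength_deltaDist_eq hol hne hr zero_lt_one h₁]
    refine (curveLength_congr (γ' := γ₁ ∘ φ₁) fun t ht => hl t (by linarith [ht.2])).trans ?_
    simpa only [e1, e2] using
      curveLength_comp_le (σ := deltaDist H) (γ := γ₁) (a := 0) (b := 1 / 2) hmono₁
  · rw [← curveLength_deltaDist_eq hol hne hr (by norm_num) (hs.mono (by norm_num) le_rfl),
      ← curveLength_deltaDist_eq hol hne hr zero_lt_one h₂]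
    refine (curveLength_congr (γ' := γ₂ ∘ φ₂) fun t ht => hg t (by linarith [ht.1])).trans ?_
    simpa only [e3, e4] using
      curveLength_comp_le (σ := deltaDist H) (γ := γ₂) (a := 1 / 2) (b := 1) hmono₂

/-- A continuous curve has no speed, so the local-to-global principle is applied to δ_BS itself,
subadditive by the triangle inequality, against (1 + ε) ℓ_δ. -/
theorem bergmanDist_le_innerDist (x y : U) : bergmanDist H r x y ≤ innerDist (deltaDist H) x y := by
  refine le_iInf₂ fun γ hγ => ?_
  obtain ⟨hγ, rfl, rfl⟩ := hγ
  have key : ∀ ε : ℝ, 0 < ε → bergmanDist H r (γ 0) (γ 1) ≤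
      ENNReal.ofReal (1 + ε) * curveLength (deltaDist H) γ 0 1 := by
    intro ε hε
    refine le_of_locally_le (A := fun s t => bergmanDist H r (γ s) (γ t))
      (B := fun s t => ENNReal.ofReal (1 + ε) * curveLength (deltaDist H) γ s t)
      zero_le_one ?_ ?_ ?_
    · exact fun s t u _ _ _ _ => bergmanDist_triangle hol hne hr _ _ _
    · intro s t u _ hst htu _
      rw [← mul_add]
      gcongr
      exact curveLength_add_le hst htu
    · intro t₀ ht₀
      filter_upwards [(hγ t₀ ht₀).eventually (eventually_bergmanDist_le hol hne r (γ t₀) hε)]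
        with t ht
      refine ⟨fun h => ht.trans (by gcongr; exact le_curveLength h), fun h => ?_⟩
      rw [bergmanDist_comm hol hne hr]
      rw [deltaDist_comm] at ht
      exact ht.trans (by gcongr; exact le_curveLength h)
  by_cases htop : curveLength (deltaDist H) γ 0 1 = ⊤
  · rw [htop]; exact le_top
  -- Adding 1 keeps the constant positive for curves of length zero.
  refine le_of_forall_le_add_ofReal_mul
    (show 0 < (curveLength (deltaDist H) γ 0 1).toReal + 1 by positivity) fun ε hε => ?_
  refine (key ε hε).trans ?_
  rw [ENNReal.ofReal_add zero_le_one hε.le, ENNReal.ofReal_one, add_mul, one_mul,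
    ENNReal.ofReal_mul hε.le]
  gcongr
  conv_lhs => rw [← ENNReal.ofReal_toReal htop]
  exact ENNReal.ofReal_le_ofReal (by linarith)

/-- The points at finite distance from x form a clopen set, because nearby points are at finite
distance from each other by the local comparison with δ. -/
theorem bergmanDist_ne_top (hU : IsConnected (U : Set ℂ)) (x y : U) : bergmanDist H r x y ≠ ⊤ := by
  have : PreconnectedSpace U := Subtype.preconnectedSpace hU.isPreconnected
  have hloc : ∀ z : U, ∀ᶠ w in 𝓝 z, bergmanDist H r z w < ⊤ := by
    intro z
    filter_upwards [eventually_bergmanDist_le hol hne r z one_pos] with w hw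
    exact hw.trans_lt (ENNReal.mul_lt_top ENNReal.ofReal_lt_top ENNReal.ofReal_lt_top)
  have hclopen : IsClopen {z : U | bergmanDist H r x z < ⊤} := by
    refine ⟨isOpen_compl_iff.1 (isOpen_iff_mem_nhds.2 fun z hz => ?_),
      isOpen_iff_mem_nhds.2 fun z hz => ?_⟩
    · filter_upwards [hloc z] with w hw hxw
      refine hz ((bergmanDist_triangle hol hne hr x w z).trans_lt (ENNReal.add_lt_top.2 ⟨hxw, ?_⟩))
      rwa [bergmanDist_comm hol hne hr]
    · filter_upwards [hloc z] with w hw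
      exact (bergmanDist_triangle hol hne hr x z w).trans_lt (ENNReal.add_lt_top.2 ⟨hz, hw⟩)
  have huniv := hclopen.eq_univ ⟨x, by simp [bergmanDist_self hol hne]⟩
  exact (show y ∈ {z : U | bergmanDist H r x z < ⊤} by rw [huniv]; trivial).ne

omit hr in
-- If k_w is a multiple of k_x for w near x, a function vanishing at x vanishes near x, hence on `U`
-- by the identity theorem. Evaluation at x is then injective on `H`.
theorem rank_le_one_of_eventually_projChart_eq_zero (hU : IsConnected (U : Set ℂ)) (x : U)
    (h : ∀ᶠ w in 𝓝 (star (x : ℂ)), projChart (kernelVec H x) (conjKernel H w) = 0) :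
    Module.rank ℂ H ≤ 1 := by
  obtain ⟨-, -, -, hloc⟩ := projChart_conjKernel_facts hol hne x
  have hx := kernelVec_ne_zero (H := H) hne x
  have hxc : (‖kernelVec H x‖ : ℂ) ≠ 0 := by exact_mod_cast norm_ne_zero_iff.2 hx
  have hvan : ∀ f : H, f x = 0 → f = 0 := by
    intro f hf
    have hfx : inner ℂ f (kernelVec H x) = 0 := by
      rw [← inner_conj_symm, inner_kernelVec, hf, map_zero]
    have hz : ∀ᶠ w in 𝓝 (x : ℂ), zeroExtend U f w = 0 := by
      have hs : ContinuousAt (star : ℂ → ℂ) (x : ℂ) := continuous_star.continuousAt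
      filter_upwards [hs.eventually h, hs.eventually hloc] with w h1 h2
      rw [projChart, sub_eq_zero] at h1
      have h3 := congrArg (inner ℂ f) h1
      rw [inner_smul_right, inner_smul_right, hfx, mul_zero, inner_conjKernel f, star_star] at h3
      exact star_eq_zero.1 ((mul_eq_zero.1 h3).resolve_left (div_ne_zero hxc h2.2))
    have heq := ((hol f).analyticOnNhd U.isOpen).eqOn_zero_of_preconnected_of_eventuallyEq_zero
      hU.isPreconnected x.2 hz
    refine RKHS.ext fun y => ?_
    have := heq y.2
    simpa [zeroExtend] using this
  have hxx : kernelVec H x x ≠ 0 := by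
    rw [← inner_kernelVec]; exact inner_self_ne_zero.2 hx
  refine rank_le_one_iff.2 ⟨kernelVec H x, fun f => ⟨f x / kernelVec H x x, ?_⟩⟩
  rw [← sub_eq_zero]
  refine hvan _ ?_
  rw [RKHS.coe_sub, RKHS.coe_smul, Pi.sub_apply, Pi.smul_apply, smul_eq_mul,
    div_mul_cancel₀ _ hxx, sub_self]

/-- The bound by θ(x, y) is not enough, since k_x and k_y may be parallel. But zeros of the chart at
x are isolated, so θ(x, ·) has a positive minimum on a small circle around x, and every curve from x
to y meets that circle. -/
theorem bergmanDist_pos (hU : IsConnected (U : Set ℂ)) (hrank : 1 < Module.rank ℂ H) {x y : U}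
    (hxy : x ≠ y) : 0 < bergmanDist H r x y := by
  obtain ⟨-, hW, hW0, hloc⟩ := projChart_conjKernel_facts (H := H) hol hne x
  have hpunct := hW.eventually_eq_zero_or_eventually_ne_zero.resolve_left fun h =>
    not_le.2 hrank (rank_le_one_of_eventually_projChart_eq_zero hol hne hU x h)
  rw [eventually_nhdsWithin_iff] at hpunct
  obtain ⟨R, hR, hball⟩ := Metric.eventually_nhds_iff_ball.1 (hpunct.and hloc)
  have hd : 0 < dist (x : ℂ) y := dist_pos.2 fun h => hxy (Subtype.ext h)
  obtain ⟨ρ, hρ, hρR, hρd⟩ : ∃ ρ : ℝ, 0 < ρ ∧ ρ < R ∧ ρ < dist (x : ℂ) y :=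
    ⟨min R (dist (x : ℂ) y) / 2, by positivity,
      by linarith [min_le_left R (dist (x : ℂ) y), hR],
      by linarith [min_le_right R (dist (x : ℂ) y), hd]⟩
  have hsph : Metric.sphere (star (x : ℂ)) ρ ⊆ Metric.ball (star (x : ℂ)) R :=
    Metric.sphere_subset_ball hρR
  have hpos : ∀ w ∈ Metric.sphere (star (x : ℂ)) ρ,
      0 < Real.sin (projAngle (kernelVec H x) (conjKernel H w)) := by
    intro w hw
    obtain ⟨h1, -, h2⟩ := hball w (hsph hw)
    have hwx : w ≠ star (x : ℂ) := by
      rintro rfl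
      rw [Metric.mem_sphere, dist_self] at hw
      exact hρ.ne hw
    rw [sin_projAngle_eq_norm_projChart h2]
    exact div_pos (norm_pos_iff.2 (h1 hwx)) (zero_lt_one.trans_le (one_le_norm_projChart_add h2))
  have hcont : ContinuousOn (fun w => projAngle (kernelVec H x) (conjKernel H w))
      (Metric.sphere (star (x : ℂ)) ρ) := by
    have hc : ContinuousOn (conjKernel H) (Metric.sphere (star (x : ℂ)) ρ) :=
      (differentiableOn_conjKernel hol).continuousOn.mono fun w hw => (hball w (hsph hw)).2.1
    unfold projAngle
    refine Real.continuous_arccos.comp_continuousOn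
      ((continuousOn_const.inner hc).norm.div (continuousOn_const.mul hc.norm) fun w hw => ?_)
    have h2 := (hball w (hsph hw)).2.2
    refine mul_ne_zero (norm_ne_zero_iff.2 (kernelVec_ne_zero hne x)) (norm_ne_zero_iff.2 ?_)
    intro h0
    rw [h0, inner_zero_right] at h2
    exact h2 rfl
  obtain ⟨w₀, hw₀, hmin⟩ := (isCompact_sphere (star (x : ℂ)) ρ).exists_isMinOn
    (NormedSpace.sphere_nonempty.2 hρ.le) hcont
  set m := projAngle (kernelVec H x) (conjKernel H w₀) with hm
  have hm0 : 0 < m := by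
    refine lt_of_le_of_ne (projAngle_nonneg _ _) fun h => ?_
    have := hpos w₀ hw₀
    rw [← hm, ← h, Real.sin_zero] at this
    exact lt_irrefl _ this
  refine (ENNReal.ofReal_pos.2 hm0).trans_le (le_iInf₂ fun γ hγ => ?_)
  obtain ⟨hγ, rfl, rfl⟩ := hγ
  have hdist : ContinuousOn (fun t => dist ((γ 0 : U) : ℂ) (γ t)) (Icc 0 1) :=
    continuous_dist.comp_continuousOn (continuousOn_const.prodMk (ContDiffOn.continuousOn hγ))
  obtain ⟨t, ht, htρ⟩ := intermediate_value_Icc zero_le_one hdist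
    (show ρ ∈ Icc _ _ from ⟨by rw [dist_self]; exact hρ.le, hρd.le⟩)
  simp only at htρ
  have ht0 : 0 < t := by
    refine lt_of_le_of_ne ht.1 fun h => ?_
    rw [← h, dist_self] at htρ
    exact hρ.ne htρ
  have hmem : star (γ t : ℂ) ∈ Metric.sphere (star (γ 0 : ℂ)) ρ := by
    rw [Metric.mem_sphere, dist_comm, ← htρ, dist_eq_norm, dist_eq_norm, ← star_sub, norm_star]
  have hle : m ≤ projAngle (kernelVec H (γ 0)) (kernelVec H (γ t)) := by
    have : m ≤ projAngle (kernelVec H (γ 0)) (conjKernel H (star (γ t : ℂ))) := hmin hmem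
    rwa [conjKernel_star] at this
  calc ENNReal.ofReal m ≤ _ := ENNReal.ofReal_le_ofReal hle
    _ ≤ bergmanLength H γ 0 t :=
      projAngle_le_bergmanLength hol hne hr ht0 (hγ.mono le_rfl ht.2)
    _ ≤ bergmanLength H γ 0 1 := by
      rw [← bergmanLength_add γ ht.1 ht.2]; exact le_self_add

end

/-! ### The main theorem -/

theorem mainTheorem2 (U : Opens ℂ) (hU : IsConnected (U : Set ℂ))
    {H : Type*} [NormedAddCommGroup H] [InnerProductSpace ℂ H] [CompleteSpace H]
    [RKHS ℂ H U ℂ]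
    (hol : ∀ f : H, DifferentiableOn ℂ (zeroExtend U f) U)
    (hne : ∀ x : U, ∃ h : H, h x ≠ 0)
    (r : ℕ∞) (hr : 1 ≤ r) :
    (∀ (γ : ℝ → U) (a b : ℝ), a < b → IsSmoothCurve r γ a b →
      curveLength (deltaDist H) γ a b = bergmanLength H γ a b ∧
      curveLength (deltaHatDist H) γ a b = bergmanLength H γ a b ∧
      curveLength (deltaCheckDist H r) γ a b = bergmanLength H γ a b) ∧
    (∀ x y : U,
      innerDist (deltaDist H) x y = bergmanDist H r x y ∧
      innerDist (deltaHatDist H) x y = bergmanDist H r x y ∧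
      innerDist (deltaCheckDist H r) x y = bergmanDist H r x y ∧
      deltaCheckDist H r x y = bergmanDist H r x y ∧
      bergmanDist H r x y ≠ ⊤) ∧
    (1 < Module.rank ℂ H → ∀ x y : U, x ≠ y →
      deltaHatDist H x y < innerDist (deltaHatDist H) x y) ∧
    (1 < Module.rank ℂ H → ∀ x y : U, x ≠ y →
      deltaDist H x y < innerDist (deltaDist H) x y) := by
  have hcheck : deltaCheckDist H r = bergmanDist H r :=
    funext₂ (deltaCheckDist_eq_bergmanDist hol hne hr)
  have hhat : ∀ x y, deltaHatDist H x y ≤ bergmanDist H r x y :=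
    deltaHatDist_le_bergmanDist hol hne hr
  have inner_mono : ∀ {σ σ' : U → U → ℝ≥0∞}, (∀ x y, σ x y ≤ σ' x y) →
      ∀ x y, innerDist σ x y ≤ innerDist σ' x y :=
    fun h x y => iInf₂_mono fun _ _ => curveLength_mono h
  have h1 : ∀ x y, bergmanDist H r x y ≤ innerDist (deltaDist H) x y :=
    bergmanDist_le_innerDist hol hne hr
  have h2 : ∀ x y, innerDist (deltaDist H) x y ≤ innerDist (deltaHatDist H) x y :=
    inner_mono deltaDist_le_deltaHatDist
  have h3 : ∀ x y, innerDist (deltaHatDist H) x y ≤ innerDist (bergmanDist H r) x y :=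
    inner_mono hhat
  have h4 : ∀ x y, innerDist (bergmanDist H r) x y ≤ bergmanDist H r x y := fun x y =>
    le_iInf₂ fun γ hγ => (iInf₂_le γ ⟨hγ.1.continuousOn, hγ.2⟩).trans
      (curveLength_bergmanDist_eq hol hne hr zero_lt_one hγ.1).le
  have hδ : ∀ x y, innerDist (deltaDist H) x y = bergmanDist H r x y := fun x y =>
    le_antisymm ((h2 x y).trans ((h3 x y).trans (h4 x y))) (h1 x y)
  have hδhat : ∀ x y, innerDist (deltaHatDist H) x y = bergmanDist H r x y := fun x y =>
    le_antisymm ((h3 x y).trans (h4 x y)) ((h1 x y).trans (h2 x y))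
  have hlt : 1 < Module.rank ℂ H → ∀ x y : U, x ≠ y →
      deltaHatDist H x y < bergmanDist H r x y := by
    intro hrank x y hxy
    -- When the kernels are parallel, δ̂ is 0 and positivity of δ_BS decides; otherwise sin t < t
    -- makes δ̂ smaller than the angle.
    rcases (projAngle_nonneg (kernelVec H x) (kernelVec H y)).eq_or_lt with h0 | h0
    · have : deltaHatDist H x y = 0 := by rw [deltaHatDist_eq, ← h0]; simp
      rw [this]
      exact bergmanDist_pos hol hne hr hU hrank hxy
    · exact (deltaHatDist_lt_projAngle h0).trans_le (projAngle_le_bergmanDist hol hne hr x y)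
  refine ⟨fun γ a b hab hγ => ?_, fun x y => ?_, fun hrank x y hxy => ?_, fun hrank x y hxy => ?_⟩
  · have e1 := curveLength_deltaDist_eq hol hne hr hab hγ
    have e2 := curveLength_bergmanDist_eq hol hne hr hab hγ
    rw [hcheck]
    exact ⟨e1, le_antisymm ((curveLength_mono hhat).trans e2.le)
      (e1.ge.trans (curveLength_mono deltaDist_le_deltaHatDist)), e2⟩
  · rw [hcheck]
    exact ⟨hδ x y, hδhat x y, le_antisymm (h4 x y) ((h1 x y).trans ((h2 x y).trans (h3 x y))), rfl,
      bergmanDist_ne_top hol hne hr hU x y⟩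
  · rw [hδhat]; exact hlt hrank x y hxy
  · rw [hδ]; exact (deltaDist_le_deltaHatDist x y).trans_lt (hlt hrank x y hxy)
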